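/- **Setting.** Let a POMDP have finite sets of states, actions, observations and rewards, of sizes $S, A, \Omega, R$, with dynamics $P(s'\mid s,a)$, $P(o\mid s',a)$, $P(r\mid s,a)$, and let $\gamma\in(0,1)$ be the discount factor, $\Gamma=\frac1{1-\gamma}$. It is represented by a dynamic decision network: a Bayesian network over $N$ binary random variables, each with at most $M\ge 1$ parents ($M$ is the largest number of parents), which encode $S_t, A_t, S_{t+1}, O_{t+1}, R_{t+1}$ as bit strings; the tables of $S_t$ encode the current belief state. The lookahead algorithm with horizon $H\ge 2$ works on the tree whose belief nodes have depths $0,\dots,H-1$ and are indexed by sequences of (action, observation) pairs. For each action at each belief node it draws $n\ge1$ reward samples and $m=\lceil(\gamma\Gamma)^2n\rceil$ observation samples by direct sampling, and at each belief node it draws $l$ belief samples, where $l=\lceil\rho^2n\rceil$ with $$\rho=\frac{R+\gamma\Gamma\Omega}{4}\cdot\frac{\sum_{k<H}\gamma^k\sum_{j\le k}S^j}{\sum_{k<H}\gamma^k}.$$ For a belief node other than the root, these are samples of the next state conditioned on the evidence $O_{t+1}=o$, for the belief state $b$ and action $a$ that lead to the node. The classical algorithm uses rejection sampling (direct samples until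 one agrees with the evidence); the quantum-classical algorithm uses quantum rejection sampling: run the circuit $G^k\mathcal B$ on $|0\dots0\rangle$, where $\mathcal B$ is the encoding circuit of the network (uniformly controlled $R_Y$ rotations, decomposed into $R_Y$ and CNOT gates), $G=\mathcal B S_0\mathcal B^\dagger S_e$, $k=\lfloor \pi/(4\theta)\rfloor$ and $\sin^2\theta=P(o\mid b,a)$; measure, and repeat until the evidence is observed. The complexity of each algorithm is the expected total number of elementary sampling steps, respectively of elementary sampling steps and primitive quantum operations, given the belief states held at the nodes of the tree (exact or estimated). A direct sample takes $\sum_i(|\mathrm{par}(X_i)|+1)$ steps. Let $\Phi$ be the family of the observation probabilities $P(o\mid b,a)$ on the observation edges of the lookahead tree, all assumed positive, and $$c_l=\sum_{p\in\Phi}p^{-1},\qquad q_l=\sum_{p\in\Phi}p^{-1/2},\qquad X=\big((R+\Omega)S^{H-1}\big)^2 .$$ Let $A\Omega\ge2$. **Statement.** Consider any family of such inputs (all quantities vary, $\gamma$ is fixed) along which $\frac1{q_l}\ll\frac{X}{A}$, that is, $\frac1{q_l}=o\big(\frac XA\big)$. Then, along the family: 1. The complexity of the classical lookahead algorithm is $$\mathcal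 O\big(nNM\,A^{H-1}\Omega^{H-1}\,((R+\Omega)S^{H-1})^2\,c_l\big).$$ 2. The complexity of the quantum-classical lookahead algorithm is $$\mathcal O\big(nN2^M A^{H-1}\Omega^{H-1}\,((R+\Omega)S^{H-1})^2\,q_l\big),$$ and if $2^M=\mathcal O(M)$, it is $$\mathcal O\big(nNM\,A^{H-1}\Omega^{H-1}\,((R+\Omega)S^{H-1})^2\,q_l\big).$$ 3. Let the rewards be bounded in absolute value by a constant $r_{\max}>0$, let $T\ge1$, $0<\delta<1$, $\varepsilon>2\gamma^H\Gamma r_{\max}$ with $\varepsilon=\mathcal O(\varepsilon-2\gamma^H\Gamma r_{\max})$, and let $n$ be of the order of the number that suffices for regret $\varepsilon$ with confidence $1-\delta$ up to time $T$, that is, $$n=\mathcal O\Big(\tfrac12\log\tfrac2\sigma\Big(\tfrac{r_{\max}}{\varepsilon-2\gamma^H\Gamma r_{\max}}(8\Gamma+4S^T)\Big)^2\Big),\quad \sigma=\frac{\delta\,(A\Omega)^{-H}}{2+A\big(T+4+A\Omega\frac{H-1}{(A\Omega-1)^2}\big)} .$$ Then the bounds in 1 and 2 (each under the same condition on $M$)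 also hold with $n$ replaced by $$\Big(\frac{S^T}{\varepsilon}\Big)^2\log\Big(\Big(T+\frac H{A\Omega}\Big)\frac{A^{H+1}\Omega^H}{\delta}\Big).$$ 4. The general complexity expressions become the simplified ones: for $c\in\{c_l,q_l\}$ and any common factors $\nu$, $w$ (such as $\nu=n$ or the factor in 3, and $w=M$ or $2^M$), $$\nu N w\,A^{H-1}\Omega^{H-1}\,(A+Xc)\;\sim\;\nu N w\,A^{H-1}\Omega^{H-1}\,X\,c .$$ 5. The speedup is $c_l/q_l$: the quotient of the simplified classical and quantum expressions (with factor $M$) equals $c_l/q_l$; the quotient of the unsimplified ones is asymptotically equivalent to $c_l/q_l$; and if $2^M=\mathcal O(M)$, the quotient of the complexities of the belief sampling in the two algorithms is $\Theta(c_l/q_l)$. Moreover $1\le c_l/q_l\le q_l$. -/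

import Mathlib

open Filter Asymptotics

noncomputable section

/-! ### Bayesian networks over binary random variables -/

/-- A Bayesian network over `N` binary random variables, listed in a topological order.
`cpt i c` is the probability that `X i = 1` given that the parents of `X i` with value `1`
are exactly those in `c`; so the table of `X i` has `2 ^ (parents i).card` entries. -/
structure BayesNet (N : ℕ) where
  parents : Fin N → Finset (Fin N)
  parents_lt : ∀ i, ∀ j ∈ parents i, j < i
  cpt : Fin N → Finset (Fin N) → unitInterval

namespace BayesNet

variable {N : ℕ}

/-- The probability `P (X i = x i | parents of X i)`. -/
def factor (B : BayesNet N) (i : Fin N) (x : Fin N → Bool) : ℝ :=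
  if x i = true then (B.cpt i ((B.parents i).filter fun j => x j = true) : ℝ)
  else 1 - (B.cpt i ((B.parents i).filter fun j => x j = true) : ℝ)

/-- The joint distribution, which is the law of one direct sample. -/
def prob (B : BayesNet N) (x : Fin N → Bool) : ℝ := ∏ i, B.factor i x

/-- The largest number of parents of a random variable. -/
def maxParents (B : BayesNet N) : ℕ := Finset.univ.sup fun i => (B.parents i).card

/-- The probability that a direct sample agrees with `e` on the evidence variables `E`. -/
def evidenceProb (B : BayesNet N) (E : Finset (Fin N)) (e : Fin N → Bool) : ℝ :=
  ∑ x : Fin N → Bool, if ∀ j ∈ E, x j = e j then B.prob x else 0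

/-- Steps of one direct sample: every variable, in topological order, reads the value of each of
its parents and is then drawn from its table. -/
def directSteps (B : BayesNet N) : ℝ := ∑ i, (((B.parents i).card : ℝ) + 1)

end BayesNet

/-- Expected number of steps of the loop "repeat an attempt until it succeeds", where the attempts
are independent, each takes `steps` steps and succeeds with probability `p`: attempt number `k`
(counted from `0`) is made with probability `(1 - p) ^ k`. -/
def repeatSteps (steps p : ℝ) : ℝ := ∑' k : ℕ, (1 - p) ^ k * steps

/-- Expected number of steps for one sample of classical rejection sampling: direct samples are
drawn until one agrees with the evidence. -/
def BayesNet.rejectionSteps {N : ℕ} (B : BayesNet N) (E : Finset (Fin N)) (e : Fin N → Bool) : ℝ :=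
  repeatSteps B.directSteps (B.evidenceProb E e)

/-! ### Quantum circuits on `N` qubits -/

/-- Pauli `X`, the rotation `R_Y(θ)`, `CNOT`, and the phase gate that multiplies by `-1` the basis
states in which all qubits of a given set are `1`. -/
inductive Gate (N : ℕ) where
  | flip (t : Fin N)
  | ry (t : Fin N) (θ : ℝ)
  | cnot (c t : Fin N)
  | phase (q : Finset (Fin N))

namespace Gate

variable {N : ℕ}

/-- Number of primitive operations charged for a gate; the phase gate is charged in proportion to
the number of its qubits. -/
def cost : Gate N → ℕ
  | flip _ => 1
  | ry _ _ => 1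
  | cnot _ _ => 1
  | phase q => q.card + 1

def inv : Gate N → Gate N
  | flip t => flip t
  | ry t θ => ry t (-θ)
  | cnot c t => cnot c t
  | phase q => phase q

/-- The action on state vectors, written in the computational basis. -/
def apply : Gate N → ((Fin N → Bool) → ℂ) → ((Fin N → Bool) → ℂ)
  | flip t, ψ => fun x => ψ (Function.update x t (!x t))
  | ry t θ, ψ => fun x =>
      if x t = true then
        (Real.sin (θ / 2) : ℂ) * ψ (Function.update x t false)
          + (Real.cos (θ / 2) : ℂ) * ψ (Function.update x t true)
      else
        (Real.cos (θ / 2) : ℂ) * ψ (Function.update x t false)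
          - (Real.sin (θ / 2) : ℂ) * ψ (Function.update x t true)
  | cnot c t, ψ => fun x => if x c = true then ψ (Function.update x t (!x t)) else ψ x
  | phase q, ψ => fun x => if ∀ j ∈ q, x j = true then -ψ x else ψ x

end Gate

/-- A circuit; the gate at the head of the list is applied first. -/
abbrev Circuit (N : ℕ) := List (Gate N)

namespace Circuit

variable {N : ℕ}

def cost (C : Circuit N) : ℕ := (C.map Gate.cost).sum

def inv (C : Circuit N) : Circuit N := (C.map Gate.inv).reverse

def run (C : Circuit N) (ψ : (Fin N → Bool) → ℂ) : (Fin N → Bool) → ℂ :=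
  C.foldl (fun φ g => g.apply φ) ψ

/-- The state `|0…0⟩`. -/
def zeroState : (Fin N → Bool) → ℂ := fun x => if x = fun _ => false then 1 else 0

/-- The rotation of qubit `t` about `Y`, uniformly controlled by the qubits in a list: the angle is
`α s` when the control qubits with value `1` are exactly those in `s`. It is decomposed into
single-qubit rotations and `CNOT`s. -/
def uniformRotation (t : Fin N) : List (Fin N) → (Finset (Fin N) → ℝ) → Circuit N
  | [], α => [Gate.ry t (α ∅)]
  | c :: cs, α =>
      uniformRotation t cs (fun s => (α s + α (insert c s)) / 2) ++ [Gate.cnot c t] ++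
        (uniformRotation t cs (fun s => (α s - α (insert c s)) / 2) ++ [Gate.cnot c t])

/-- `𝓕 P 𝓕`: multiplies by `-1` the basis states that agree with `e` on the qubits in `E`. -/
def phaseFlip (E : Finset (Fin N)) (e : Fin N → Bool) : Circuit N :=
  ((List.finRange N).filter fun j => j ∈ E ∧ e j = false).map Gate.flip ++ [Gate.phase E] ++
    ((List.finRange N).filter fun j => j ∈ E ∧ e j = false).map Gate.flip

end Circuit

namespace BayesNet

variable {N : ℕ}

/-- The circuit `𝓑` that encodes a Bayesian network. The angle `2 arcsin √P₁` is
`2 arctan √(P₁ / P₀)` when `P₀ ≠ 0`, and `π` when `P₀ = 0`. -/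
def encode (B : BayesNet N) : Circuit N :=
  (List.finRange N).flatMap fun i =>
    Circuit.uniformRotation i ((List.finRange N).filter fun j => j ∈ B.parents i)
      (fun s => 2 * Real.arcsin (Real.sqrt (B.cpt i s)))

/-- The amplitude amplification operator `G = 𝓑 S₀ 𝓑† S_e`. -/
def amplify (B : BayesNet N) (E : Finset (Fin N)) (e : Fin N → Bool) : Circuit N :=
  Circuit.phaseFlip E e ++ B.encode.inv ++
    (Circuit.phaseFlip Finset.univ fun _ => false) ++ B.encode

/-- The number of amplification rounds, `⌊π / (4 θ)⌋` with `sin² θ = P(e)`. -/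
def rounds (B : BayesNet N) (E : Finset (Fin N)) (e : Fin N → Bool) : ℕ :=
  ⌊Real.pi / (4 * Real.arcsin (Real.sqrt (B.evidenceProb E e)))⌋₊

/-- One attempt of quantum rejection sampling, before the measurement: `G ^ k 𝓑`. -/
def attempt (B : BayesNet N) (E : Finset (Fin N)) (e : Fin N → Bool) : Circuit N :=
  B.encode ++ (List.replicate (B.rounds E e) (B.amplify E e)).flatten

/-- The probability that the measurement after one attempt shows the evidence. -/
def attemptProb (B : BayesNet N) (E : Finset (Fin N)) (e : Fin N → Bool) : ℝ :=
  ∑ x : Fin N → Bool,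
    if ∀ j ∈ E, x j = e j then ‖(B.attempt E e).run Circuit.zeroState x‖ ^ 2 else 0

/-- Expected number of primitive operations for one sample of quantum rejection sampling: run the
circuit on `|0…0⟩`, measure the `N` qubits, and repeat until the evidence is observed. -/
def quantumRejectionSteps (B : BayesNet N) (E : Finset (Fin N)) (e : Fin N → Bool) : ℝ :=
  repeatSteps ((Circuit.cost (B.attempt E e) : ℝ) + N) (B.attemptProb E e)

end BayesNet

/-! ### POMDPs and dynamic decision networks -/

/-- A POMDP with `nS` states, `nA` actions, `nO` observations and `nR` rewards:
`trans s a s' = P(s' | s, a)`, `sensor s' a o = P(o | s', a)`, `rewardProb s a r = P(r | s, a)`. -/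
structure POMDP (nS nA nO nR : ℕ) where
  trans : Fin nS → Fin nA → Fin nS → ℝ
  trans_nonneg : ∀ s a s', 0 ≤ trans s a s'
  trans_sum : ∀ s a, ∑ s', trans s a s' = 1
  sensor : Fin nS → Fin nA → Fin nO → ℝ
  sensor_nonneg : ∀ s a o, 0 ≤ sensor s a o
  sensor_sum : ∀ s a, ∑ o, sensor s a o = 1
  rewardProb : Fin nS → Fin nA → Fin nR → ℝ
  rewardProb_nonneg : ∀ s a r, 0 ≤ rewardProb s a r
  rewardProb_sum : ∀ s a, ∑ r, rewardProb s a r = 1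
  rewardValue : Fin nR → ℝ

/-- The observation probability `P(o | b, a)`. -/
def POMDP.obsProb {nS nA nO nR : ℕ} (P : POMDP nS nA nO nR) (b : Fin nS → ℝ)
    (a : Fin nA) (o : Fin nO) : ℝ :=
  ∑ s', P.sensor s' a o * ∑ s, P.trans s a s' * b s

/-- A dynamic decision network for a POMDP: a Bayesian network whose `N` binary variables are those
of `S_t` (`kS` of them), `A_t` (`kA`), `S_{t+1}` (`kS`), `O_{t+1}` (`kO`) and `R_{t+1}` (`kR`), in
this order in the sum type. States, actions, observations and rewards are encoded as bit strings.
`S_t` and `A_t` depend on nothing else, and the remaining tables give the environment dynamics. -/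
structure DDN {nS nA nO nR : ℕ} (P : POMDP nS nA nO nR) (N kS kA kO kR : ℕ) where
  net : BayesNet N
  var : (Fin kS ⊕ Fin kA ⊕ Fin kS ⊕ Fin kO ⊕ Fin kR) ≃ Fin N
  cur_root : ∀ k, ∀ j ∈ net.parents (var (.inl k)), ∃ k', j = var (.inl k')
  act_root : ∀ k, net.parents (var (.inr (.inl k))) = ∅
  encS : Fin nS ↪ (Fin kS → Bool)
  encA : Fin nA ↪ (Fin kA → Bool)
  encO : Fin nO ↪ (Fin kO → Bool)
  encR : Fin nR ↪ (Fin kR → Bool)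
  models : ∀ s a s' o r,
    ∏ v : Fin kS ⊕ Fin kO ⊕ Fin kR, net.factor (var (.inr (.inr v)))
      (fun i => Sum.elim (encS s) (Sum.elim (encA a) (Sum.elim (encS s')
        (Sum.elim (encO o) (encR r)))) (var.symm i))
      = P.trans s a s' * P.sensor s' a o * P.rewardProb s a r

namespace DDN

variable {nS nA nO nR : ℕ} {P : POMDP nS nA nO nR} {N kS kA kO kR : ℕ}

/-- The network in which the tables of `S_t` are `β` and the tables of `A_t` force the action `a`;
the graph is unchanged. -/
def load (D : DDN P N kS kA kO kR) (β : Fin kS → Finset (Fin N) → unitInterval) (a : Fin nA) :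
    BayesNet N where
  parents := D.net.parents
  parents_lt := D.net.parents_lt
  cpt i c := match D.var.symm i with
    | .inl k => β k c
    | .inr (.inl k) => if D.encA a k = true then 1 else 0
    | .inr (.inr _) => D.net.cpt i c

/-- The belief state that the tables `β` of `S_t` encode. -/
def belief (D : DDN P N kS kA kO kR) (β : Fin kS → Finset (Fin N) → unitInterval)
    (s : Fin nS) : ℝ :=
  ∏ k : Fin kS,
    if D.encS s k = true then
      (β k ((D.net.parents (D.var (.inl k))).filter fun j =>
        Sum.elim (D.encS s) (fun _ => false) (D.var.symm j) = true) : ℝ)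
    else
      1 - (β k ((D.net.parents (D.var (.inl k))).filter fun j =>
        Sum.elim (D.encS s) (fun _ => false) (D.var.symm j) = true) : ℝ)

/-- The variables of `O_{t+1}`. -/
def obsVars (D : DDN P N kS kA kO kR) : Finset (Fin N) :=
  Finset.univ.image fun k : Fin kO => D.var (.inr (.inr (.inr (.inl k))))

/-- The evidence `O_{t+1} = o`, as an assignment (its values off `obsVars` are irrelevant). -/
def obsEvidence (D : DDN P N kS kA kO kR) (o : Fin nO) (i : Fin N) : Bool :=
  match D.var.symm i with
  | .inr (.inr (.inr (.inl k))) => D.encO o k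
  | _ => false

end DDN

/-! ### The lookahead algorithm -/

/-- An input of the lookahead algorithm together with the belief states of its lookahead tree. A
belief node of depth `d` is a sequence of `d` pairs (action, observation); at each belief node the
algorithm holds a belief state (the exact one, or one estimated from samples), encoded in the
tables of `S_t` of the network. No relation between the belief states of different nodes is
imposed, so that every outcome of the sampling is covered. `n` is the number of reward samples. -/
structure Lookahead where
  (nS nA nO nR : ℕ)
  pomdp : POMDP nS nA nO nR
  (N kS kA kO kR : ℕ)
  ddn : DDN pomdp N kS kA kO kR
  H : ℕ
  n : ℕ
  tables : (d : ℕ) → (Fin d → Fin nA × Fin nO) → Fin kS → Finset (Fin N) → unitInterval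
  belief_sum : ∀ d h, ∑ s, ddn.belief (tables d h) s = 1

namespace Lookahead

/-- The largest number of parents of a random variable of the network. -/
def M (L : Lookahead) : ℕ := L.ddn.net.maxParents

/-- The observation probability `P(o | b, a)` at a belief node. -/
def obsProb (L : Lookahead) (d : ℕ) (h : Fin d → Fin L.nA × Fin L.nO) (a : Fin L.nA)
    (o : Fin L.nO) : ℝ :=
  L.pomdp.obsProb (L.ddn.belief (L.tables d h)) a o

/-- Sum over all observation edges of the lookahead tree, that is over the belief nodes other than
the root; the belief nodes have depths `0, …, H - 1`. -/
def edgeSum (L : Lookahead)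
    (f : (d : ℕ) → (Fin d → Fin L.nA × Fin L.nO) → Fin L.nA → Fin L.nO → ℝ) : ℝ :=
  ∑ d ∈ Finset.range (L.H - 1), ∑ h : Fin d → Fin L.nA × Fin L.nO, ∑ a, ∑ o, f d h a o

/-- `c_l`, the sum of `p ^ (-1)` over the observation probabilities in the lookahead tree. -/
def cl (L : Lookahead) : ℝ := L.edgeSum fun d h a o => (L.obsProb d h a o)⁻¹

/-- `q_l`, the sum of `p ^ (-1/2)` over the observation probabilities in the lookahead tree. -/
def ql (L : Lookahead) : ℝ := L.edgeSum fun d h a o => L.obsProb d h a o ^ (-(1 / 2) : ℝ)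

/-- Number of samples for an observation distribution: `m = (γ Γ)² n` with `Γ = 1 / (1 - γ)`. -/
def m (L : Lookahead) (γ : ℝ) : ℕ := ⌈(γ * (1 - γ)⁻¹) ^ 2 * L.n⌉₊

/-- Number of samples for a belief update, `√(l / n)` being
`(R + γ Γ Ω) / 4 · (∑_{k < H} γ ^ k ∑_{j ≤ k} S ^ j) / ∑_{k < H} γ ^ k`. -/
def l (L : Lookahead) (γ : ℝ) : ℕ :=
  ⌈(1 / 4 * (L.nR + γ * (1 - γ)⁻¹ * L.nO) *
      ((∑ k ∈ Finset.range L.H, γ ^ k * ∑ j ∈ Finset.range (k + 1), (L.nS : ℝ) ^ j) /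
        ∑ k ∈ Finset.range L.H, γ ^ k)) ^ 2 * L.n⌉₊

/-- Steps of the reward and observation sampling: `n + m` direct samples for every action at every
belief node of the lookahead tree. -/
def directSamplingSteps (L : Lookahead) (γ : ℝ) : ℝ :=
  ∑ d ∈ Finset.range L.H, ∑ _h : Fin d → Fin L.nA × Fin L.nO, ∑ _a : Fin L.nA,
    ((L.n : ℝ) + L.m γ) * L.ddn.net.directSteps

/-- Expected steps of the belief sampling in the classical algorithm: `l` samples at every belief
node, by rejection sampling, except that the root has no evidence. -/
def classicalBeliefSteps (L : Lookahead) (γ : ℝ) : ℝ :=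
  L.l γ * L.ddn.net.directSteps + L.edgeSum fun d h a o =>
    L.l γ * (L.ddn.load (L.tables d h) a).rejectionSteps L.ddn.obsVars (L.ddn.obsEvidence o)

/-- Expected steps of the belief sampling in the quantum-classical algorithm: the same, with
quantum rejection sampling. -/
def quantumBeliefSteps (L : Lookahead) (γ : ℝ) : ℝ :=
  L.l γ * L.ddn.net.directSteps + L.edgeSum fun d h a o =>
    L.l γ * (L.ddn.load (L.tables d h) a).quantumRejectionSteps L.ddn.obsVars
      (L.ddn.obsEvidence o)

/-- Expected steps of the classical lookahead algorithm. -/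
def classicalSteps (L : Lookahead) (γ : ℝ) : ℝ :=
  L.directSamplingSteps γ + L.classicalBeliefSteps γ

/-- Expected steps of the quantum-classical lookahead algorithm. -/
def quantumSteps (L : Lookahead) (γ : ℝ) : ℝ :=
  L.directSamplingSteps γ + L.quantumBeliefSteps γ

/-- `((R + Ω) S ^ (H - 1)) ^ 2`. -/
def X (L : Lookahead) : ℝ := (((L.nR : ℝ) + L.nO) * (L.nS : ℝ) ^ (L.H - 1)) ^ 2

/-- The expression `ν N w A ^ (H-1) Ω ^ (H-1) (A + ((R + Ω) S ^ (H-1)) ^ 2 c)`. -/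
def full (L : Lookahead) (ν w c : ℝ) : ℝ :=
  ν * L.N * w * (L.nA : ℝ) ^ (L.H - 1) * (L.nO : ℝ) ^ (L.H - 1) * (L.nA + L.X * c)

/-- The expression `ν N w A ^ (H-1) Ω ^ (H-1) ((R + Ω) S ^ (H-1)) ^ 2 c`. -/
def reduced (L : Lookahead) (ν w c : ℝ) : ℝ :=
  ν * L.N * w * (L.nA : ℝ) ^ (L.H - 1) * (L.nO : ℝ) ^ (L.H - 1) * L.X * c

/-- The failure probability `σ` of one sampling operation that belongs to the confidence `1 - δ`
and the stopping time `T`. -/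
def sigma (L : Lookahead) (T : ℕ) (δ : ℝ) : ℝ :=
  δ * (((L.nA : ℝ) * L.nO) ^ L.H)⁻¹ *
    (2 + L.nA * (T + 4 + L.nA * L.nO * (((L.H : ℝ) - 1) / ((L.nA : ℝ) * L.nO - 1) ^ 2)))⁻¹

/-- The number of samples `n` that suffices for regret `ε` with confidence `1 - δ` up to the
stopping time `T`, when the rewards are bounded by `rmax`. -/
def sampleBound (L : Lookahead) (γ rmax : ℝ) (T : ℕ) (ε δ : ℝ) : ℝ :=
  1 / 2 * Real.log (2 / L.sigma T δ) *
    (rmax / (ε - 2 * γ ^ L.H * (1 - γ)⁻¹ * rmax) * (8 * (1 - γ)⁻¹ + 4 * (L.nS : ℝ) ^ T)) ^ 2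

/-- `(S ^ T / ε) ^ 2 log ((T + H / (A Ω)) A ^ (H+1) Ω ^ H / δ)`. -/
def precisionFactor (L : Lookahead) (T : ℕ) (ε δ : ℝ) : ℝ :=
  ((L.nS : ℝ) ^ T / ε) ^ 2 *
    Real.log ((T + L.H / ((L.nA : ℝ) * L.nO)) * ((L.nA : ℝ) ^ (L.H + 1) * (L.nO : ℝ) ^ L.H / δ))

end Lookahead

end

/-! Both complexities are a number of samples times a cost per sample. In direct sampling the node
counts `(AΩ) ^ d` form a geometric series with ratio at least 2, so the deepest level dominates;
this produces the term `A` in `full`. In belief sampling, `l` is at most a constant times `X n`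
(`l_le`), because `∑ γ ^ k (k + 1)` converges and the constant does not depend on `H`.

At an edge with observation probability `p`, the evidence has probability exactly `p` in the loaded
network (`evidenceProb_load`), so a classical sample costs `directSteps / p`. In the quantum case,
uniformly controlled rotations prepare the square roots of the joint distribution
(`run_encode_zeroState`). Up to sign, `G` rotates by `2θ` in the plane spanned by the parts of this
state inside and outside the evidence (`run_iterate_amplify`). With the chosen number of rounds an
attempt succeeds with probability at least `1/2` (`attemptProb_mem_Icc`). The number of rounds is of
order `1/√p`, up to an additive 1, and a round costs `O(N 2 ^ M)`. Summing over edges yields `c_l`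
and `q_l`, and each complexity is at most a constant times `full` (`full_bound`).

Multiplied by `A q_l`, the hypothesis says `A = o(X q_l)`; since `q_l ≤ c_l`, also `A = o(X c_l)`.
Hence `full ~ reduced`, which gives the simplified bounds and the equivalence of the quotients. The
form with precision and confidence follows from `log (2/σ) ≤ 3 log Y`, where `Y` is the argument of
the simplified logarithm. For the `Θ` statement, `2 ^ M = O(M)` forces `M` to be bounded, so quantum
and classical unit costs agree up to constants. Finally `1 ≤ c_l / q_l ≤ q_l` compares a sum of
numbers `1/√p ≥ 1` with the sum of their squares. -/

/-! ### Gates as real orthogonal matrices. -/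

namespace Gate

variable {N : ℕ}

/-- The basis state obtained by negating qubit `t`. -/
def toggle (t : Fin N) (x : Fin N → Bool) : Fin N → Bool := Function.update x t (!x t)

@[simp] theorem toggle_self (t : Fin N) (x : Fin N → Bool) : toggle t x t = !x t := by
  simp [toggle]

theorem toggle_of_ne {t j : Fin N} (h : j ≠ t) (x : Fin N → Bool) : toggle t x j = x j := by
  simp [toggle, h]

@[simp] theorem toggle_toggle (t : Fin N) (x : Fin N → Bool) : toggle t (toggle t x) = x := by
  funext j
  by_cases h : j = t
  · subst h; simp
  · simp [toggle_of_ne h]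

theorem toggle_involutive (t : Fin N) : Function.Involutive (toggle t) := toggle_toggle t

/-- The sign of the off-diagonal entry of a rotation in the row of `x`. -/
def rowSign (t : Fin N) (x : Fin N → Bool) : ℂ := if x t = true then 1 else -1

@[simp] theorem rowSign_toggle (t : Fin N) (x : Fin N → Bool) :
    rowSign t (toggle t x) = -rowSign t x := by
  cases h : x t <;> simp [rowSign, h]

@[simp] theorem rowSign_mul_self (t : Fin N) (x : Fin N → Bool) :
    rowSign t x * rowSign t x = 1 := by
  cases h : x t <;> simp [rowSign, h]

theorem apply_flip (t : Fin N) (ψ : (Fin N → Bool) → ℂ) (x : Fin N → Bool) :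
    (flip t).apply ψ x = ψ (toggle t x) := rfl

theorem apply_cnot (c t : Fin N) (ψ : (Fin N → Bool) → ℂ) (x : Fin N → Bool) :
    (cnot c t).apply ψ x = if x c = true then ψ (toggle t x) else ψ x := rfl

theorem apply_phase (q : Finset (Fin N)) (ψ : (Fin N → Bool) → ℂ) (x : Fin N → Bool) :
    (phase q).apply ψ x = if ∀ j ∈ q, x j = true then -ψ x else ψ x := rfl

theorem apply_ry (t : Fin N) (θ : ℝ) (ψ : (Fin N → Bool) → ℂ) (x : Fin N → Bool) :
    (ry t θ).apply ψ x = (Real.cos (θ / 2) : ℂ) * ψ x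
      + rowSign t x * (Real.sin (θ / 2) : ℂ) * ψ (toggle t x) := by
  cases h : x t
  · have h1 : Function.update x t false = x := by rw [← h]; simp
    have h2 : Function.update x t true = toggle t x := by simp [toggle, h]
    simp only [apply, rowSign, h, h1, h2]
    simp; ring
  · have h1 : Function.update x t true = x := by rw [← h]; simp
    have h2 : Function.update x t false = toggle t x := by simp [toggle, h]
    simp only [apply, rowSign, h, h1, h2]
    simp; ring

/-- A controlled negation whose control and target coincide is not a unitary operation. -/
def Proper : Gate N → Prop
  | cnot c t => c ≠ t
  | _ => True

theorem Proper.inv {g : Gate N} (h : g.Proper) : g.inv.Proper := by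
  cases g with
  | cnot c t => exact h
  | _ => trivial

theorem apply_linear (g : Gate N) (a b : ℂ) (φ ψ : (Fin N → Bool) → ℂ) :
    g.apply (fun x => a * φ x + b * ψ x) = fun x => a * g.apply φ x + b * g.apply ψ x := by
  funext x
  cases g with
  | flip t => rfl
  | ry t θ => simp only [apply_ry]; ring
  | cnot c t => simp only [apply_cnot]; split_ifs <;> rfl
  | phase q => simp only [apply_phase]; split_ifs <;> ring

theorem inv_apply_apply {g : Gate N} (hg : g.Proper) (ψ : (Fin N → Bool) → ℂ) :
    g.inv.apply (g.apply ψ) = ψ := by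
  funext x
  cases g with
  | flip t => simp [Gate.inv, apply_flip]
  | ry t θ =>
    have h : (Real.cos (θ / 2) : ℂ) ^ 2 + (Real.sin (θ / 2) : ℂ) ^ 2 = 1 := by
      exact_mod_cast Real.cos_sq_add_sin_sq (θ / 2)
    simp only [Gate.inv, apply_ry, neg_div, Real.cos_neg, Real.sin_neg, rowSign_toggle,
      toggle_toggle, Complex.ofReal_neg]
    linear_combination ψ x * h + (Real.sin (θ / 2) : ℂ) ^ 2 * ψ x * rowSign_mul_self t x
  | cnot c t =>
    have hc : toggle t x c = x c := toggle_of_ne hg x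
    cases h : x c <;> simp [Gate.inv, apply_cnot, hc, h]
  | phase q => simp only [Gate.inv, apply_phase]; split_ifs <;> simp

/-- All gates are real orthogonal matrices: the inverse is the transpose. -/
theorem sum_mul_apply {g : Gate N} (hg : g.Proper) (φ ψ : (Fin N → Bool) → ℂ) :
    ∑ x, φ x * g.apply ψ x = ∑ x, g.inv.apply φ x * ψ x := by
  cases g with
  | flip t =>
    refine Fintype.sum_equiv (toggle_involutive t).toPerm _ _ fun x => ?_
    simp [Gate.inv, apply_flip]
  | ry t θ =>
    simp only [Gate.inv, apply_ry, mul_add, add_mul, Finset.sum_add_distrib]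
    congr 1
    · simp only [neg_div, Real.cos_neg]
      exact Finset.sum_congr rfl fun x _ => by ring
    · refine Fintype.sum_equiv (toggle_involutive t).toPerm _ _ fun x => ?_
      simp [neg_div]
      ring
  | cnot c t =>
    -- `CNOT` permutes the basis states by an involution, which serves as the change of variables in
    -- the sum.
    have hinv : Function.Involutive fun x : Fin N → Bool =>
        if x c = true then toggle t x else x := by
      intro x
      have hc : toggle t x c = x c := toggle_of_ne hg x
      cases h : x c <;> simp [hc, h]
    refine Fintype.sum_equiv hinv.toPerm _ _ fun x => ?_
    have hc : toggle t x c = x c := toggle_of_ne hg x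
    cases h : x c <;> simp [Gate.inv, apply_cnot, hc, h]
  | phase q =>
    refine Finset.sum_congr rfl fun x _ => ?_
    simp only [Gate.inv, apply_phase]
    split_ifs <;> ring

end Gate

/-! ### Semantics of circuits, uniformly controlled rotations and phase flips. -/

namespace Circuit

variable {N : ℕ}

@[simp] theorem run_nil (ψ : (Fin N → Bool) → ℂ) : run [] ψ = ψ := rfl

@[simp] theorem run_cons (g : Gate N) (C : Circuit N) (ψ : (Fin N → Bool) → ℂ) :
    run (g :: C) ψ = run C (g.apply ψ) := rfl

theorem run_append (C C' : Circuit N) (ψ : (Fin N → Bool) → ℂ) :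
    run (C ++ C') ψ = run C' (run C ψ) := by
  simp [run, List.foldl_append]

theorem run_linear (C : Circuit N) (a b : ℂ) (φ ψ : (Fin N → Bool) → ℂ) :
    run C (fun x => a * φ x + b * ψ x) = fun x => a * run C φ x + b * run C ψ x := by
  induction C generalizing φ ψ with
  | nil => rfl
  | cons g C ih => simp only [run_cons, Gate.apply_linear, ih]

/-- All gates of the circuit are unitary. -/
def Proper (C : Circuit N) : Prop := ∀ g ∈ C, g.Proper

theorem inv_cons (g : Gate N) (C : Circuit N) : inv (g :: C) = inv C ++ [g.inv] := by
  simp [inv]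

theorem run_inv_run {C : Circuit N} (hC : C.Proper) (ψ : (Fin N → Bool) → ℂ) :
    run C.inv (run C ψ) = ψ := by
  induction C generalizing ψ with
  | nil => rfl
  | cons g C ih =>
    rw [inv_cons, run_append, run_cons g C, ih fun g' h => hC g' (List.mem_cons_of_mem _ h)]
    exact Gate.inv_apply_apply (hC g List.mem_cons_self) ψ

theorem _root_.Gate.inv_inv (g : Gate N) : g.inv.inv = g := by
  cases g <;> simp [Gate.inv]

theorem inv_inv (C : Circuit N) : inv (inv C) = C := by
  simp [inv, List.map_reverse, Function.comp_def, Gate.inv_inv]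

theorem Proper.inv {C : Circuit N} (hC : C.Proper) : Proper C.inv := by
  intro g hg
  simp only [Circuit.inv, List.mem_reverse, List.mem_map] at hg
  obtain ⟨g', h, rfl⟩ := hg
  exact (hC g' h).inv

theorem run_run_inv {C : Circuit N} (hC : C.Proper) (ψ : (Fin N → Bool) → ℂ) :
    run C (run C.inv ψ) = ψ := by
  simpa [inv_inv] using run_inv_run hC.inv ψ

theorem sum_mul_run {C : Circuit N} (hC : C.Proper) (φ ψ : (Fin N → Bool) → ℂ) :
    ∑ x, φ x * run C ψ x = ∑ x, run C.inv φ x * ψ x := by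
  induction C generalizing φ ψ with
  | nil => rfl
  | cons g C ih =>
    rw [inv_cons, run_append, run_cons, ih fun g' h => hC g' (List.mem_cons_of_mem _ h)]
    exact Gate.sum_mul_apply (hC g List.mem_cons_self) _ ψ

theorem Proper.append {C C' : Circuit N} (hC : C.Proper) (hC' : C'.Proper) :
    Proper (C ++ C') := fun g hg => (List.mem_append.1 hg).elim (hC g) (hC' g)

theorem uniformRotation_proper (t : Fin N) (cs : List (Fin N)) (α : Finset (Fin N) → ℝ)
    (ht : t ∉ cs) : (uniformRotation t cs α).Proper := by
  induction cs generalizing α with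
  | nil => intro g hg; simp [uniformRotation] at hg; subst hg; trivial
  | cons c cs ih =>
    simp only [List.mem_cons, not_or] at ht
    have h : Proper [Gate.cnot c t] := by
      intro g hg; simp at hg; subst hg; exact fun h => ht.1 h.symm
    exact ((ih _ ht.2).append h).append ((ih _ ht.2).append h)

/-- Conjugating a `Y` rotation by a negation reverses its angle. So the two halves compose to the
sum of their angles when the control `c` is 0 and to the difference when it is 1; the half-sum and
half-difference are chosen to give `α s` and `α (insert c s)`. -/
theorem run_uniformRotation (t : Fin N) (cs : List (Fin N)) (α : Finset (Fin N) → ℝ)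
    (ht : t ∉ cs) (hcs : cs.Nodup) (ψ : (Fin N → Bool) → ℂ) (x : Fin N → Bool) :
    run (uniformRotation t cs α) ψ x =
      (Gate.ry t (α (cs.toFinset.filter fun j => x j = true))).apply ψ x := by
  induction cs generalizing α ψ x with
  | nil => simp [uniformRotation]
  | cons c cs ih =>
    simp only [List.mem_cons, not_or] at ht
    obtain ⟨hc, hcs⟩ := List.nodup_cons.1 hcs
    have htog : Gate.toggle t x c = x c := Gate.toggle_of_ne (Ne.symm ht.1) x
    -- The target is not a control, so both rows mixed by the rotation select the same angle.
    have hset : (cs.toFinset.filter fun j => Gate.toggle t x j = true) =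
        cs.toFinset.filter fun j => x j = true := by
      refine Finset.filter_congr fun j hj => ?_
      rw [Gate.toggle_of_ne]
      rintro rfl
      exact ht.2 (by simpa using hj)
    simp only [uniformRotation, run_append, run_cons, run_nil]
    have hfilter : ((c :: cs).toFinset.filter fun j => x j = true) =
        if x c = true then insert c (cs.toFinset.filter fun j => x j = true)
        else cs.toFinset.filter fun j => x j = true := by
      rw [List.toFinset_cons, Finset.filter_insert]
    rw [hfilter]
    set s := cs.toFinset.filter fun j => x j = true
    have hsq := Gate.rowSign_mul_self t x
    cases hx : x c
    · rw [Gate.apply_cnot, if_neg (by simp [hx]), ih _ ht.2 hcs, Gate.apply_ry,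
        Gate.apply_cnot, Gate.apply_cnot, htog, if_neg (by simp [hx]), if_neg (by simp [hx]),
        ih _ ht.2 hcs, ih _ ht.2 hcs, Gate.apply_ry, Gate.apply_ry, hset, Gate.apply_ry,
        Gate.toggle_toggle, Gate.rowSign_toggle]
      simp only [Bool.false_eq_true, if_false]
      have h : α s / 2 = (α s + α (insert c s)) / 2 / 2 + (α s - α (insert c s)) / 2 / 2 := by ring
      rw [h, Real.cos_add, Real.sin_add]
      push_cast
      linear_combination (-Complex.sin ((α s - α (insert c s)) / 2 / 2) *
        Complex.sin ((α s + α (insert c s)) / 2 / 2) * ψ x) * hsq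
    · rw [Gate.apply_cnot, if_pos hx, ih _ ht.2 hcs, Gate.apply_ry,
        Gate.apply_cnot, Gate.apply_cnot, Gate.toggle_toggle, htog, if_pos hx, if_pos hx,
        ih _ ht.2 hcs, ih _ ht.2 hcs, Gate.apply_ry, Gate.apply_ry, hset, Gate.apply_ry,
        Gate.toggle_toggle, Gate.rowSign_toggle]
      simp only [if_true]
      have h : α (insert c s) / 2 = (α s + α (insert c s)) / 2 / 2 - (α s - α (insert c s)) / 2 / 2 := by
        ring
      rw [h, Real.cos_sub, Real.sin_sub]
      push_cast
      linear_combination (Complex.sin ((α s - α (insert c s)) / 2 / 2) *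
        Complex.sin ((α s + α (insert c s)) / 2 / 2) * ψ x) * hsq

theorem run_map_flip (l : List (Fin N)) (hl : l.Nodup) (ψ : (Fin N → Bool) → ℂ)
    (x : Fin N → Bool) :
    run (l.map Gate.flip) ψ x = ψ fun j => if j ∈ l then !x j else x j := by
  induction l generalizing ψ with
  | nil => simp
  | cons t l ih =>
    obtain ⟨ht, hl⟩ := List.nodup_cons.1 hl
    rw [List.map_cons, run_cons, ih hl, Gate.apply_flip]
    congr 1
    funext j
    by_cases h : j = t
    · subst h; simp [ht]
    · simp [Gate.toggle_of_ne h, h]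

/-- Negating the qubits of `E` on which `e` is 0 turns agreement with `e` into "all ones on `E`",
the condition of the phase gate; the second layer of negations undoes the first. -/
theorem run_phaseFlip (E : Finset (Fin N)) (e : Fin N → Bool) (ψ : (Fin N → Bool) → ℂ)
    (x : Fin N → Bool) :
    run (phaseFlip E e) ψ x = if ∀ j ∈ E, x j = e j then -ψ x else ψ x := by
  have hl : ((List.finRange N).filter fun j => j ∈ E ∧ e j = false).Nodup :=
    (List.nodup_finRange N).filter _
  rw [phaseFlip, run_append, run_append, run_map_flip _ hl, run_cons, run_nil, Gate.apply_phase,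
    run_map_flip _ hl]
  congr 1
  · refine propext <| forall₂_congr fun j hj => ?_
    cases h : e j <;> simp [hj, h]
  · congr 2
    funext j
    by_cases h : j ∈ E ∧ e j = false <;> simp [h]
  · congr 1
    funext j
    by_cases h : j ∈ E ∧ e j = false <;> simp [h]

end Circuit

/-! ### The encoding circuit and amplitude amplification. -/

namespace BayesNet

variable {N : ℕ} (B : BayesNet N)

theorem factor_nonneg (i : Fin N) (x : Fin N → Bool) : 0 ≤ B.factor i x := by
  rw [factor]
  split_ifs
  · exact (B.cpt i _).2.1
  · exact sub_nonneg.2 (B.cpt i _).2.2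

theorem prob_nonneg (x : Fin N → Bool) : 0 ≤ B.prob x :=
  Finset.prod_nonneg fun i _ => B.factor_nonneg i x

theorem factor_congr {i : Fin N} {x y : Fin N → Bool} (hi : x i = y i)
    (h : ∀ j ∈ B.parents i, x j = y j) : B.factor i x = B.factor i y := by
  have : ((B.parents i).filter fun j => x j = true) = (B.parents i).filter fun j => y j = true :=
    Finset.filter_congr fun j hj => by rw [h j hj]
  rw [factor, factor, hi, this]

theorem controls_nodup (i : Fin N) :
    ((List.finRange N).filter fun j => j ∈ B.parents i).Nodup :=
  (List.nodup_finRange N).filter _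

theorem target_notMem_controls (i : Fin N) :
    i ∉ (List.finRange N).filter fun j => j ∈ B.parents i := by
  simpa using fun h => lt_irrefl i (B.parents_lt i i h)

theorem encode_proper : B.encode.Proper := by
  intro g hg
  obtain ⟨i, -, hi⟩ := List.mem_flatMap.1 hg
  exact Circuit.uniformRotation_proper _ _ _ (B.target_notMem_controls i) g hi

/-- The rotation for variable `i`, applied to a state in which qubit `i` is `0`. -/
theorem run_rotation (i : Fin N) (ψ : (Fin N → Bool) → ℂ) (x : Fin N → Bool)
    (hψ : ∀ y, y i = true → ψ y = 0) :
    Circuit.run (Circuit.uniformRotation i ((List.finRange N).filter fun j => j ∈ B.parents i)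
      (fun s => 2 * Real.arcsin (Real.sqrt (B.cpt i s)))) ψ x =
      (Real.sqrt (B.factor i x) : ℂ) * ψ (Function.update x i false) := by
  rw [Circuit.run_uniformRotation _ _ _ (B.target_notMem_controls i) (B.controls_nodup i),
    Gate.apply_ry]
  have hs : (((List.finRange N).filter fun j => j ∈ B.parents i).toFinset.filter
      fun j => x j = true) = (B.parents i).filter fun j => x j = true := by
    ext j; simp
  rw [hs]
  set p := B.cpt i ((B.parents i).filter fun j => x j = true) with hp
  have h0 : -1 ≤ Real.sqrt p := by linarith [Real.sqrt_nonneg (p : ℝ)]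
  have h1 : Real.sqrt p ≤ 1 := Real.sqrt_le_one.2 p.2.2
  rw [mul_div_cancel_left₀ _ (two_ne_zero' ℝ), Real.sin_arcsin h0 h1, Real.cos_arcsin,
    Real.sq_sqrt p.2.1]
  cases h : x i
  · have hx : Function.update x i false = x := by rw [← h]; simp
    rw [hψ (Gate.toggle i x) (by simp [h]), hx]
    simp [factor, h, hp]
  · have hx : Function.update x i false = Gate.toggle i x := by simp [Gate.toggle, h]
    rw [hψ x h, hx]
    simp [factor, h, hp, Gate.rowSign]

/-- Induction along the topological order: after `k` rotations the qubits from `k` on are still 0,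
so `run_rotation` applies to the next one and contributes one more factor. -/
theorem run_encode_take (k : ℕ) (hk : k ≤ N) (x : Fin N → Bool) :
    Circuit.run (((List.finRange N).take k).flatMap fun i =>
      Circuit.uniformRotation i ((List.finRange N).filter fun j => j ∈ B.parents i)
        (fun s => 2 * Real.arcsin (Real.sqrt (B.cpt i s)))) Circuit.zeroState x =
      if ∀ j : Fin N, k ≤ j → x j = false then
        ∏ j ∈ Finset.univ.filter (fun j : Fin N => (j : ℕ) < k), (Real.sqrt (B.factor j x) : ℂ)
      else 0 := by
  induction k generalizing x with
  | zero =>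
    simp [Circuit.zeroState, funext_iff]
  | succ k ih =>
    have ih := ih (by omega)
    set i : Fin N := ⟨k, hk⟩ with hi
    have htake : (List.finRange N).take (k + 1) = (List.finRange N).take k ++ [i] := by
      rw [List.take_add_one]
      rw [List.getElem?_eq_getElem (by simpa using hk)]
      simp [hi]
    rw [htake, List.flatMap_append, Circuit.run_append, List.flatMap_singleton, B.run_rotation, ih]
    · have hcond : (∀ j : Fin N, k ≤ j → Function.update x i false j = false) ↔
          ∀ j : Fin N, k + 1 ≤ j → x j = false := by
        constructor
        · intro h j hj
          have := h j (by omega)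
          rwa [Function.update_of_ne] at this
          rintro rfl; simp [hi] at hj
        · intro h j hj
          by_cases hji : j = i
          · simp [hji]
          · rw [Function.update_of_ne hji]
            refine h j (lt_of_le_of_ne hj fun h' => hji ?_)
            ext; simp [hi, h']
      simp only [hcond, mul_ite, mul_zero]
      congr 1
      have hset : Finset.univ.filter (fun j : Fin N => (j : ℕ) < k + 1) =
          insert i (Finset.univ.filter (fun j : Fin N => (j : ℕ) < k)) := by
        ext j
        simp only [Finset.mem_filter, Finset.mem_univ, true_and, Finset.mem_insert, Fin.ext_iff, hi]
        omega
      rw [hset, Finset.prod_insert (by simp [hi])]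
      congr 1
      refine Finset.prod_congr rfl fun j hj => ?_
      have hjk : (j : ℕ) < k := by simpa using hj
      -- The parents of a variable before `k` also lie before `k`, so clearing qubit `k` leaves its
      -- factor unchanged.
      rw [B.factor_congr (y := x)]
      · exact Function.update_of_ne (by rintro rfl; simp [hi] at hjk) _ _
      · intro j' hj'
        have : (j' : ℕ) < j := B.parents_lt j j' hj'
        exact Function.update_of_ne (by rintro rfl; simp [hi] at this; omega) _ _
    · intro y hy
      rw [ih, if_neg]
      intro h
      simp [h i (by simp [hi])] at hy

/-- The encoding circuit prepares the square roots of the joint distribution. -/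
theorem run_encode_zeroState :
    B.encode.run Circuit.zeroState = fun x => (Real.sqrt (B.prob x) : ℂ) := by
  funext x
  have h := B.run_encode_take N le_rfl x
  rw [List.take_of_length_le (by simp)] at h
  rw [encode, h, if_pos fun j hj => absurd j.2 (by omega), prob, Real.sqrt_prod]
  · simp
  · exact fun j _ => B.factor_nonneg j x

/-- The inverse of the encoding circuit is its transpose, so its `|0…0⟩` amplitude is the overlap
with the encoded state. -/
theorem sum_encode_mul (φ : (Fin N → Bool) → ℂ) :
    B.encode.inv.run φ (fun _ => false) = ∑ x, (Real.sqrt (B.prob x) : ℂ) * φ x := by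
  have h := Circuit.sum_mul_run B.encode_proper φ Circuit.zeroState
  rw [run_encode_zeroState] at h
  simpa [Circuit.zeroState, mul_comm] using h.symm

/-- Normalization is read off from unitarity: the overlap of the encoded state with itself is the
amplitude of `|0…0⟩` after running the circuit and its inverse. -/
theorem sum_prob : ∑ x, B.prob x = 1 := by
  have h := B.sum_encode_mul (B.encode.run Circuit.zeroState)
  rw [Circuit.run_inv_run B.encode_proper, run_encode_zeroState] at h
  have h' : (∑ x, (Real.sqrt (B.prob x) : ℂ) * (Real.sqrt (B.prob x) : ℂ)) =
      ((∑ x, B.prob x : ℝ) : ℂ) := by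
    push_cast
    refine Finset.sum_congr rfl fun x _ => ?_
    rw [← Complex.ofReal_mul, Real.mul_self_sqrt (B.prob_nonneg x)]
  rw [h'] at h
  have : (1 : ℂ) = ((∑ x, B.prob x : ℝ) : ℂ) := by simpa [Circuit.zeroState] using h
  exact_mod_cast this.symm

variable (E : Finset (Fin N)) (e : Fin N → Bool)

theorem evidenceProb_le_one : B.evidenceProb E e ≤ 1 := by
  rw [← B.sum_prob]
  exact Finset.sum_le_sum fun x _ => by split_ifs <;> simp [B.prob_nonneg x]

/-- The state with amplitude `u` on the part of the encoded state that agrees with the evidence,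
and `v` on the rest. -/
noncomputable def planeState (u v : ℂ) : (Fin N → Bool) → ℂ := fun x =>
  if ∀ j ∈ E, x j = e j then u * (Real.sqrt (B.prob x) : ℂ) else v * (Real.sqrt (B.prob x) : ℂ)

/-- The reflection `𝓑 S₀ 𝓑†` is `1 - 2 |ψ⟩⟨ψ|` for the encoded state `ψ`. -/
theorem run_reflection (φ : (Fin N → Bool) → ℂ) :
    B.encode.run ((Circuit.phaseFlip Finset.univ fun _ => false).run (B.encode.inv.run φ)) =
      fun x => φ x - 2 * (∑ y, (Real.sqrt (B.prob y) : ℂ) * φ y) * (Real.sqrt (B.prob x) : ℂ) := by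
  have h : (Circuit.phaseFlip Finset.univ fun _ => false).run (B.encode.inv.run φ) =
      fun x => 1 * B.encode.inv.run φ x +
        (-2 * ∑ y, (Real.sqrt (B.prob y) : ℂ) * φ y) * Circuit.zeroState x := by
    funext x
    rw [Circuit.run_phaseFlip, ← sum_encode_mul]
    by_cases hx : x = fun _ => false
    · subst hx
      simp [Circuit.zeroState]; ring
    · have : ¬ ∀ j, x j = false := fun h => hx (funext h)
      simp [Circuit.zeroState, hx, this]
  rw [h, Circuit.run_linear, Circuit.run_run_inv B.encode_proper, run_encode_zeroState]
  funext x
  ring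

theorem sum_sqrt_mul_planeState (u v : ℂ) :
    ∑ x, (Real.sqrt (B.prob x) : ℂ) * B.planeState E e u v x =
      u * (B.evidenceProb E e : ℂ) + v * (1 - (B.evidenceProb E e : ℂ)) := by
  have hsum : (1 : ℂ) = ∑ x, (B.prob x : ℂ) := by exact_mod_cast B.sum_prob.symm
  rw [hsum, evidenceProb, Complex.ofReal_sum, ← Finset.sum_sub_distrib, Finset.mul_sum,
    Finset.mul_sum, ← Finset.sum_add_distrib]
  refine Finset.sum_congr rfl fun x _ => ?_
  have hsq : (Real.sqrt (B.prob x) : ℂ) * (Real.sqrt (B.prob x) : ℂ) = (B.prob x : ℂ) := by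
    rw [← Complex.ofReal_mul, Real.mul_self_sqrt (B.prob_nonneg x)]
  simp only [planeState]
  split_ifs
  · linear_combination u * hsq
  · push_cast; linear_combination v * hsq

theorem run_amplify (u v : ℝ) :
    (B.amplify E e).run (B.planeState E e u v) = B.planeState E e
      ((-u - 2 * (-u * B.evidenceProb E e + v * (1 - B.evidenceProb E e)) : ℝ) : ℂ)
      ((v - 2 * (-u * B.evidenceProb E e + v * (1 - B.evidenceProb E e)) : ℝ) : ℂ) := by
  have h : (Circuit.phaseFlip E e).run (B.planeState E e u v) = B.planeState E e (-(u : ℂ)) v := by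
    funext x
    rw [Circuit.run_phaseFlip]
    simp only [planeState]
    split_ifs <;> ring
  rw [amplify, Circuit.run_append, Circuit.run_append, Circuit.run_append, h, run_reflection,
    sum_sqrt_mul_planeState]
  funext x
  simp only [planeState]
  push_cast
  split_ifs <;> ring

/-- By the addition formulas each round advances the angle by `2θ`. The sign `(-1) ^ k` appears
because `𝓑 S₀ 𝓑† S_e` lacks the overall minus sign of the usual rotation; it disappears in
probabilities. The amplitudes are relative to the two components of the encoded state, hence the
divisions by `sin θ` and `cos θ`. -/
theorem run_iterate_amplify {θ : ℝ} (hs : Real.sin θ ≠ 0) (hc : Real.cos θ ≠ 0)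
    (hθ : B.evidenceProb E e = Real.sin θ ^ 2) (k : ℕ) :
    Circuit.run (B.encode ++ (List.replicate k (B.amplify E e)).flatten) Circuit.zeroState =
      B.planeState E e (((-1) ^ k * (Real.sin ((2 * k + 1) * θ) / Real.sin θ) : ℝ) : ℂ)
        (((-1) ^ k * (Real.cos ((2 * k + 1) * θ) / Real.cos θ) : ℝ) : ℂ) := by
  induction k with
  | zero =>
    simp only [List.replicate_zero, List.flatten_nil, List.append_nil, run_encode_zeroState]
    funext x
    simp only [planeState, pow_zero, CharP.cast_eq_zero, mul_zero, zero_add, one_mul, div_self hs,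
      div_self hc, Complex.ofReal_one, ite_self]
  | succ k ih =>
    rw [List.replicate_succ', List.flatten_append, ← List.append_assoc, Circuit.run_append, ih]
    simp only [List.flatten_cons, List.flatten_nil, List.append_nil]
    rw [run_amplify, hθ]
    have hcos : 1 - Real.sin θ ^ 2 = Real.cos θ ^ 2 := (Real.cos_sq' θ).symm
    have hsin2 : Real.sin ((2 * ((k + 1 : ℕ) : ℝ) + 1) * θ) =
        Real.sin ((2 * k + 1) * θ) * (2 * Real.cos θ ^ 2 - 1) +
          Real.cos ((2 * k + 1) * θ) * (2 * Real.sin θ * Real.cos θ) := by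
      rw [← Real.cos_two_mul, ← Real.sin_two_mul, ← Real.sin_add]; push_cast; ring_nf
    have hcos2 : Real.cos ((2 * ((k + 1 : ℕ) : ℝ) + 1) * θ) =
        Real.cos ((2 * k + 1) * θ) * (2 * Real.cos θ ^ 2 - 1) -
          Real.sin ((2 * k + 1) * θ) * (2 * Real.sin θ * Real.cos θ) := by
      rw [← Real.cos_two_mul, ← Real.sin_two_mul, ← Real.cos_add]; push_cast; ring_nf
    set a := Real.sin ((2 * k + 1) * θ)
    set b := Real.cos ((2 * k + 1) * θ)
    congr 2
    · rw [hsin2, hcos, pow_succ (-1 : ℝ) k]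
      generalize (-1 : ℝ) ^ k = c
      field_simp
      linear_combination (2 * a * c) * Real.sin_sq_add_cos_sq θ
    · rw [hcos2, hcos, pow_succ (-1 : ℝ) k]
      generalize (-1 : ℝ) ^ k = c
      field_simp
      ring

theorem attemptProb_of_run {u v : ℝ}
    (h : (B.attempt E e).run Circuit.zeroState = B.planeState E e u v) :
    B.attemptProb E e = u ^ 2 * B.evidenceProb E e := by
  rw [attemptProb, h, evidenceProb, Finset.mul_sum]
  refine Finset.sum_congr rfl fun x _ => ?_
  simp only [planeState]
  split_ifs
  · rw [← Complex.ofReal_mul, Complex.norm_real, Real.norm_eq_abs, sq_abs, mul_pow,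
      Real.sq_sqrt (B.prob_nonneg x)]
  · simp

theorem rounds_eq_zero (h : 1 / 2 < B.evidenceProb E e) : B.rounds E e = 0 := by
  rw [rounds, Nat.floor_eq_zero, div_lt_one]
  · have : Real.pi / 4 < Real.arcsin (Real.sqrt (B.evidenceProb E e)) := by
      rw [Real.lt_arcsin_iff_sin_lt' ⟨by linarith [Real.pi_pos], by linarith [Real.pi_pos]⟩,
        Real.sin_pi_div_four]
      refine Real.lt_sqrt_of_sq_lt ?_
      rw [div_pow, Real.sq_sqrt zero_le_two]; linarith
    linarith
  · have := Real.arcsin_pos.2 (Real.sqrt_pos.2 (by linarith : 0 < B.evidenceProb E e))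
    linarith

/-- If `p > 1/2`, no round is made and the probability is `p`. Otherwise the floor puts `(2k+1)θ`
within `θ` of `π/2`, so the probability `sin² ((2k+1)θ)` is at least `cos² θ = 1 - p ≥ 1/2`. -/
theorem attemptProb_mem_Icc (hp : 0 < B.evidenceProb E e) :
    B.attemptProb E e ∈ Set.Icc (1 / 2) 1 := by
  have hp1 := B.evidenceProb_le_one E e
  rcases lt_or_ge (1 / 2) (B.evidenceProb E e) with h | h
  · have hrun : (B.attempt E e).run Circuit.zeroState = B.planeState E e (1 : ℝ) (1 : ℝ) := by
      rw [attempt, B.rounds_eq_zero E e h]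
      simp only [List.replicate_zero, List.flatten_nil, List.append_nil, run_encode_zeroState]
      funext x
      simp [planeState]
    rw [B.attemptProb_of_run E e hrun]
    constructor <;> linarith
  · set θ := Real.arcsin (Real.sqrt (B.evidenceProb E e)) with hθ
    have hsin : Real.sin θ = Real.sqrt (B.evidenceProb E e) :=
      Real.sin_arcsin (by linarith [Real.sqrt_nonneg (B.evidenceProb E e)]) (Real.sqrt_le_one.2 hp1)
    have hθ0 : 0 < θ := Real.arcsin_pos.2 (Real.sqrt_pos.2 hp)
    have hθ1 : θ ≤ Real.pi / 4 := by
      rw [hθ, Real.arcsin_le_iff_le_sin' ⟨by linarith [Real.pi_pos], by linarith [Real.pi_pos]⟩,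
        Real.sin_pi_div_four]
      refine Real.sqrt_le_iff.2 ⟨by positivity, ?_⟩
      rw [div_pow, Real.sq_sqrt zero_le_two]; linarith
    have hs : 0 < Real.sin θ := by rw [hsin]; exact Real.sqrt_pos.2 hp
    have hc : 0 < Real.cos θ :=
      Real.cos_pos_of_mem_Ioo ⟨by linarith [Real.pi_pos], by linarith [Real.pi_pos]⟩
    have hpθ : B.evidenceProb E e = Real.sin θ ^ 2 := by rw [hsin, Real.sq_sqrt hp.le]
    rw [B.attemptProb_of_run E e (B.run_iterate_amplify E e hs.ne' hc.ne' hpθ _), hpθ]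
    set k := B.rounds E e with hk
    have hval : ((-1 : ℝ) ^ k * (Real.sin ((2 * k + 1) * θ) / Real.sin θ)) ^ 2 * Real.sin θ ^ 2 =
        Real.sin ((2 * k + 1) * θ) ^ 2 := by
      rw [mul_pow, ← pow_mul, mul_comm k 2, pow_mul]
      field_simp
      norm_num
    rw [hval]
    refine ⟨?_, Real.sin_sq_le_one _⟩
    have hk1 : (k : ℝ) ≤ Real.pi / (4 * θ) := Nat.floor_le (by positivity)
    have hk2 : Real.pi / (4 * θ) < k + 1 := Nat.lt_floor_add_one _
    rw [le_div_iff₀ (by linarith)] at hk1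
    rw [div_lt_iff₀ (by linarith)] at hk2
    have hcos : Real.cos θ ≤ Real.sin ((2 * k + 1) * θ) := by
      rw [← Real.cos_sub_pi_div_two, ← Real.cos_abs ((2 * k + 1) * θ - Real.pi / 2)]
      refine Real.cos_le_cos_of_nonneg_of_le_pi (abs_nonneg _) (by linarith) ?_
      rw [abs_le]
      constructor <;> nlinarith
    calc (1 : ℝ) / 2 ≤ Real.cos θ ^ 2 := by rw [Real.cos_sq', ← hpθ]; linarith
      _ ≤ _ := pow_le_pow_left₀ hc.le hcos 2

end BayesNet

/-! ### Gate counts and the expected cost of one sample. -/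

namespace Circuit

variable {N : ℕ}

theorem cost_append (C C' : Circuit N) : cost (C ++ C') = cost C + cost C' := by
  simp [cost]

theorem cost_inv (C : Circuit N) : cost C.inv = cost C := by
  have h : (Gate.cost ∘ Gate.inv : Gate N → ℕ) = Gate.cost := by
    funext g; cases g <;> rfl
  simp [cost, inv, List.map_reverse, List.sum_reverse, h]

theorem cost_flatten_replicate (k : ℕ) (C : Circuit N) :
    cost (List.replicate k C).flatten = k * cost C := by
  induction k with
  | zero => simp [cost]
  | succ k ih => rw [List.replicate_succ, List.flatten_cons, cost_append, ih]; ring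

/-- The recursion is `c ↦ 2c + 2` starting from 1; adding 2 makes it a doubling and avoids natural
subtraction. -/
theorem cost_uniformRotation (t : Fin N) (cs : List (Fin N)) (α : Finset (Fin N) → ℝ) :
    cost (uniformRotation t cs α) + 2 = 3 * 2 ^ cs.length := by
  induction cs generalizing α with
  | nil => rfl
  | cons c cs ih =>
    have hc : cost [Gate.cnot c t] = 1 := rfl
    simp only [uniformRotation, cost_append, hc, List.length_cons, pow_succ]
    have h1 := ih fun s => (α s + α (insert c s)) / 2
    have h2 := ih fun s => (α s - α (insert c s)) / 2
    omega

theorem cost_phaseFlip_le (E : Finset (Fin N)) (e : Fin N → Bool) (hN : 1 ≤ N) :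
    cost (phaseFlip E e) ≤ 4 * N := by
  have h : ∀ l : List (Fin N), cost (l.map Gate.flip) = l.length := by
    intro l
    induction l with
    | nil => rfl
    | cons t l ih =>
      have : cost ((t :: l).map Gate.flip) = 1 + cost (l.map Gate.flip) := by
        simp [cost, Gate.cost]
      rw [this, ih, List.length_cons, add_comm]
  have hl : ((List.finRange N).filter fun j => j ∈ E ∧ e j = false).length ≤ N :=
    (List.length_filter_le _ _).trans (by simp)
  have hE : E.card ≤ N := by simpa using E.card_le_univ
  have hph : cost [Gate.phase E] = E.card + 1 := rfl
  rw [phaseFlip, cost_append, cost_append, h, hph]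
  omega

end Circuit

theorem repeatSteps_eq {p : ℝ} (s : ℝ) (h0 : 0 < p) (h1 : p ≤ 1) : repeatSteps s p = s / p := by
  rw [repeatSteps, tsum_mul_right, tsum_geometric_of_lt_one (by linarith) (by linarith)]
  rw [sub_sub_cancel, div_eq_inv_mul]

namespace BayesNet

variable {N : ℕ} (B : BayesNet N)

theorem cost_encode : (Circuit.cost B.encode : ℝ) =
    ∑ i, (3 * 2 ^ (B.parents i).card - 2 : ℝ) := by
  have hlen : ∀ i, ((List.finRange N).filter fun j => j ∈ B.parents i).length =
      (B.parents i).card := by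
    intro i
    rw [← List.toFinset_card_of_nodup (B.controls_nodup i)]
    congr 1
    ext j; simp
  have h : ∀ l : List (Fin N), (Circuit.cost (l.flatMap fun i =>
      Circuit.uniformRotation i ((List.finRange N).filter fun j => j ∈ B.parents i)
        (fun s => 2 * Real.arcsin (Real.sqrt (B.cpt i s)))) : ℝ) =
      (l.map fun i => (3 * 2 ^ (B.parents i).card - 2 : ℝ)).sum := by
    intro l
    induction l with
    | nil => simp [Circuit.cost]
    | cons i l ih =>
      have hi := Circuit.cost_uniformRotation i ((List.finRange N).filter fun j => j ∈ B.parents i)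
        (fun s => 2 * Real.arcsin (Real.sqrt (B.cpt i s)))
      rw [hlen] at hi
      have hi' : (Circuit.cost (Circuit.uniformRotation i
          ((List.finRange N).filter fun j => j ∈ B.parents i)
          (fun s => 2 * Real.arcsin (Real.sqrt (B.cpt i s)))) : ℝ) + 2 =
          3 * 2 ^ (B.parents i).card := by exact_mod_cast hi
      rw [List.flatMap_cons, Circuit.cost_append, Nat.cast_add, ih, List.map_cons, List.sum_cons]
      linarith
  rw [encode, h, ← List.ofFn_eq_map, List.sum_ofFn]

theorem card_parents_le (i : Fin N) : (B.parents i).card ≤ B.maxParents :=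
  Finset.le_sup (f := fun i => (B.parents i).card) (Finset.mem_univ i)

theorem cost_encode_le : (Circuit.cost B.encode : ℝ) ≤ 3 * (N * 2 ^ B.maxParents) := by
  rw [cost_encode]
  have h : ∀ i ∈ Finset.univ, (3 * 2 ^ (B.parents i).card - 2 : ℝ) ≤ 3 * 2 ^ B.maxParents := by
    intro i _
    have : (2 : ℝ) ^ (B.parents i).card ≤ 2 ^ B.maxParents :=
      pow_le_pow_right₀ one_le_two (B.card_parents_le i)
    linarith
  refine (Finset.sum_le_card_nsmul _ _ _ h).trans (le_of_eq ?_)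
  simp; ring

/-- Termwise `k + 1 ≤ 2 ^ k ≤ 3 * 2 ^ k - 2`. This puts the lower bound for the quantum cost in the
units of the classical one. -/
theorem directSteps_le_cost_encode : B.directSteps ≤ Circuit.cost B.encode := by
  rw [cost_encode, directSteps]
  refine Finset.sum_le_sum fun i _ => ?_
  have h : (B.parents i).card + 1 ≤ 2 ^ (B.parents i).card := Nat.lt_two_pow_self
  have h' : ((B.parents i).card : ℝ) + 1 ≤ 2 ^ (B.parents i).card := by exact_mod_cast h
  have : (0 : ℝ) ≤ (B.parents i).card := Nat.cast_nonneg _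
  linarith

theorem le_directSteps : (N : ℝ) ≤ B.directSteps := by
  have : ∑ _i : Fin N, (1 : ℝ) ≤ B.directSteps :=
    Finset.sum_le_sum fun i _ => by simp
  simpa using this

theorem directSteps_le : B.directSteps ≤ N * (B.maxParents + 1) := by
  have h : ∀ i ∈ Finset.univ, ((B.parents i).card : ℝ) + 1 ≤ B.maxParents + 1 := by
    intro i _
    have : ((B.parents i).card : ℝ) ≤ B.maxParents := by exact_mod_cast B.card_parents_le i
    linarith
  refine (Finset.sum_le_card_nsmul _ _ _ h).trans (le_of_eq ?_)
  rw [nsmul_eq_mul, Finset.card_univ, Fintype.card_fin]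

variable (E : Finset (Fin N)) (e : Fin N → Bool)

theorem cost_attempt : Circuit.cost (B.attempt E e) = Circuit.cost B.encode + B.rounds E e *
    (Circuit.cost (Circuit.phaseFlip E e) + Circuit.cost B.encode +
      Circuit.cost (Circuit.phaseFlip (Finset.univ : Finset (Fin N)) fun _ => false) +
      Circuit.cost B.encode) := by
  rw [attempt, Circuit.cost_append, Circuit.cost_flatten_replicate, amplify, Circuit.cost_append,
    Circuit.cost_append, Circuit.cost_append, Circuit.cost_inv]

/-- From `√p = sin θ ≤ θ` and `π ≤ 4`. -/
theorem rounds_le (hp : 0 < B.evidenceProb E e) :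
    (B.rounds E e : ℝ) ≤ 1 / Real.sqrt (B.evidenceProb E e) := by
  have hs := Real.sqrt_pos.2 hp
  have hs1 := Real.sqrt_le_one.2 (B.evidenceProb_le_one E e)
  have hθ0 := Real.arcsin_pos.2 hs
  have hle : Real.sqrt (B.evidenceProb E e) ≤ Real.arcsin (Real.sqrt (B.evidenceProb E e)) := by
    have := Real.sin_le hθ0.le
    rwa [Real.sin_arcsin (by linarith) hs1] at this
  refine (Nat.floor_le (by positivity)).trans ?_
  rw [div_le_div_iff₀ (by positivity) hs]
  nlinarith [Real.pi_le_four]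

/-- From Jordan's inequality `2θ/π ≤ sin θ = √p`; the `+ 1` pays for the floor. -/
theorem le_rounds (hp : 0 < B.evidenceProb E e) :
    1 / (2 * Real.sqrt (B.evidenceProb E e)) ≤ B.rounds E e + 1 := by
  have hs := Real.sqrt_pos.2 hp
  have hs1 := Real.sqrt_le_one.2 (B.evidenceProb_le_one E e)
  have hθ0 := Real.arcsin_pos.2 hs
  have hle : 2 / Real.pi * Real.arcsin (Real.sqrt (B.evidenceProb E e)) ≤
      Real.sqrt (B.evidenceProb E e) := by
    have := Real.mul_le_sin hθ0.le (Real.arcsin_le_pi_div_two _)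
    rwa [Real.sin_arcsin (by linarith) hs1] at this
  refine le_trans ?_ (Nat.lt_floor_add_one _).le
  rw [div_mul_eq_mul_div, div_le_iff₀ Real.pi_pos] at hle
  rw [div_le_div_iff₀ (by positivity) (by positivity)]
  linarith

theorem rejectionSteps_eq (hp : 0 < B.evidenceProb E e) :
    B.rejectionSteps E e = B.directSteps * (B.evidenceProb E e)⁻¹ := by
  rw [rejectionSteps, repeatSteps_eq _ hp (B.evidenceProb_le_one E e), div_eq_mul_inv]

theorem quantumRejectionSteps_le (hN : 1 ≤ N) (hp : 0 < B.evidenceProb E e) :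
    B.quantumRejectionSteps E e ≤
      36 * (N * 2 ^ B.maxParents) * (1 / Real.sqrt (B.evidenceProb E e)) := by
  obtain ⟨h1, h2⟩ := B.attemptProb_mem_Icc E e hp
  rw [quantumRejectionSteps, repeatSteps_eq _ (by linarith) h2, div_le_iff₀ (by linarith)]
  have hs := Real.sqrt_pos.2 hp
  have hs1 := Real.sqrt_le_one.2 (B.evidenceProb_le_one E e)
  have hone : 1 ≤ 1 / Real.sqrt (B.evidenceProb E e) := by rwa [le_div_iff₀ hs, one_mul]
  have hk := B.rounds_le E e hp
  have hk0 : (0 : ℝ) ≤ B.rounds E e := Nat.cast_nonneg _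
  have hc := B.cost_encode_le
  have hf1 : (Circuit.cost (Circuit.phaseFlip E e) : ℝ) ≤ 4 * N := by
    exact_mod_cast Circuit.cost_phaseFlip_le E e hN
  have hf2 : (Circuit.cost (Circuit.phaseFlip (Finset.univ : Finset (Fin N)) fun _ => false) : ℝ) ≤
      4 * N := by
    exact_mod_cast Circuit.cost_phaseFlip_le Finset.univ (fun _ => false) hN
  have hW : (N : ℝ) ≤ N * 2 ^ B.maxParents :=
    le_mul_of_one_le_right (Nat.cast_nonneg _) (one_le_pow₀ one_le_two)
  rw [cost_attempt]
  push_cast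
  set W : ℝ := N * 2 ^ B.maxParents
  set r := 1 / Real.sqrt (B.evidenceProb E e)
  have hW0 : 0 ≤ W := (Nat.cast_nonneg N).trans hW
  -- With `N ≤ W` the attempt costs at most `4W + 14rW ≤ 18Wr`, since `r ≥ 1`; success probability
  -- at least `1/2` doubles this to 36.
  calc _ ≤ 3 * W + B.rounds E e * (4 * N + 3 * W + 4 * N + 3 * W) + N := by gcongr
    _ ≤ 3 * W + r * (4 * W + 3 * W + 4 * W + 3 * W) + W := by gcongr
    _ ≤ 18 * W * r := by nlinarith
    _ ≤ 36 * W * r * B.attemptProb E e := by nlinarith [mul_nonneg hW0 (zero_le_one.trans hone)]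

theorem le_quantumRejectionSteps (hp : 0 < B.evidenceProb E e) :
    1 / 2 * B.directSteps * (1 / Real.sqrt (B.evidenceProb E e)) ≤
      B.quantumRejectionSteps E e := by
  obtain ⟨h1, h2⟩ := B.attemptProb_mem_Icc E e hp
  rw [quantumRejectionSteps, repeatSteps_eq _ (by linarith) h2, le_div_iff₀ (by linarith)]
  have hs := Real.sqrt_pos.2 hp
  have hD : 0 ≤ B.directSteps := (Nat.cast_nonneg N).trans B.le_directSteps
  have hc := B.directSteps_le_cost_encode
  have hk := B.le_rounds E e hp
  have hk0 : (0 : ℝ) ≤ B.rounds E e := Nat.cast_nonneg _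
  rw [cost_attempt]
  push_cast
  calc _ ≤ 1 / 2 * B.directSteps * (1 / Real.sqrt (B.evidenceProb E e)) :=
        mul_le_of_le_one_right (by positivity) h2
    _ = B.directSteps * (1 / (2 * Real.sqrt (B.evidenceProb E e))) := by field_simp
    _ ≤ B.directSteps * (B.rounds E e + 1) := by gcongr
    -- Only the initial `𝓑` and one of the two encodings in each round are kept.
    _ ≤ Circuit.cost B.encode * (B.rounds E e + 1) := by gcongr
    _ = Circuit.cost B.encode + B.rounds E e * (0 + Circuit.cost B.encode + 0 + 0) + 0 := by ring
    _ ≤ _ := by gcongr <;> positivity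

end BayesNet

/-! ### Evidence probabilities in the loaded network. -/

/-- If an injective family carries the whole mass of a distribution, then so it does for every
event. -/
theorem sum_ite_eq_of_mass {α β : Type*} [Fintype α] [Fintype β] {f : α → β}
    (hf : Function.Injective f) {w : β → ℝ} (hw : ∀ x, 0 ≤ w x)
    (hmass : ∑ a, w (f a) = ∑ x, w x) (Q : β → Prop) [DecidablePred Q] :
    ∑ x, (if Q x then w x else 0) = ∑ a, if Q (f a) then w (f a) else 0 := by
  classical
  have himage : ∑ x ∈ Finset.univ.image f, w x = ∑ a, w (f a) :=
    Finset.sum_image fun a _ b _ h => hf h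
  have hzero : ∑ x ∈ (Finset.univ.image f)ᶜ, w x = 0 := by
    have := Finset.sum_add_sum_compl (Finset.univ.image f) w
    linarith
  rw [Finset.sum_eq_zero_iff_of_nonneg fun x _ => hw x] at hzero
  rw [← Finset.sum_image (s := Finset.univ) (g := f)
    (f := fun x => if Q x then w x else 0) fun a _ b _ h => hf h]
  refine (Finset.sum_subset (Finset.subset_univ _) fun x _ hx => ?_).symm
  rw [hzero x (by simpa using hx), ite_self]

namespace DDN

variable {nS nA nO nR : ℕ} {P : POMDP nS nA nO nR} {N kS kA kO kR : ℕ}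
  (D : DDN P N kS kA kO kR)

/-- The assignment that encodes a transition. -/
def encodeStep (a : Fin nA) (y : Fin nS × Fin nS × Fin nO × Fin nR) : Fin N → Bool :=
  fun i => Sum.elim (D.encS y.1) (Sum.elim (D.encA a) (Sum.elim (D.encS y.2.1)
    (Sum.elim (D.encO y.2.2.1) (D.encR y.2.2.2)))) (D.var.symm i)

theorem encodeStep_injective (a : Fin nA) : Function.Injective (D.encodeStep a) := by
  rintro ⟨s, s', o, r⟩ ⟨t, t', o', r'⟩ h
  have h' : ∀ v, D.encodeStep a (s, s', o, r) (D.var v) = D.encodeStep a (t, t', o', r') (D.var v) :=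
    fun v => by rw [h]
  simp only [encodeStep, Equiv.symm_apply_apply] at h'
  have h1 : s = t := D.encS.injective (funext fun k => h' (.inl k))
  have h2 : s' = t' := D.encS.injective (funext fun k => h' (.inr (.inr (.inl k))))
  have h3 : o = o' := D.encO.injective (funext fun k => h' (.inr (.inr (.inr (.inl k)))))
  have h4 : r = r' := D.encR.injective (funext fun k => h' (.inr (.inr (.inr (.inr k)))))
  rw [h1, h2, h3, h4]

theorem load_prob_encodeStep (β : Fin kS → Finset (Fin N) → unitInterval) (a : Fin nA)
    (y : Fin nS × Fin nS × Fin nO × Fin nR) :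
    (D.load β a).prob (D.encodeStep a y) = D.belief β y.1 *
      (P.trans y.1 a y.2.1 * P.sensor y.2.1 a y.2.2.1 * P.rewardProb y.1 a y.2.2.2) := by
  obtain ⟨s, s', o, r⟩ := y
  rw [BayesNet.prob, ← Equiv.prod_comp D.var, Fintype.prod_sum_type, Fintype.prod_sum_type,
    ← D.models s a s' o r]
  have hS : ∀ k, (D.load β a).factor (D.var (.inl k)) (D.encodeStep a (s, s', o, r)) =
      if D.encS s k = true then
        (β k ((D.net.parents (D.var (.inl k))).filter fun j =>
          Sum.elim (D.encS s) (fun _ => false) (D.var.symm j) = true) : ℝ)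
      else 1 - (β k ((D.net.parents (D.var (.inl k))).filter fun j =>
          Sum.elim (D.encS s) (fun _ => false) (D.var.symm j) = true) : ℝ) := by
    intro k
    -- By `cur_root` the parents of a bit of `S_t` are bits of `S_t`, so the default `false` in
    -- `belief` is never read.
    have hset : ((D.net.parents (D.var (.inl k))).filter fun j =>
        D.encodeStep a (s, s', o, r) j = true) =
        (D.net.parents (D.var (.inl k))).filter fun j =>
          Sum.elim (D.encS s) (fun _ => false) (D.var.symm j) = true := by
      refine Finset.filter_congr fun j hj => ?_
      obtain ⟨k', rfl⟩ := D.cur_root k j hj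
      simp [encodeStep]
    simp only [BayesNet.factor, load, hset, Equiv.symm_apply_apply]
    simp [encodeStep]
  have hA : ∀ k, (D.load β a).factor (D.var (.inr (.inl k))) (D.encodeStep a (s, s', o, r)) = 1 := by
    intro k
    simp only [BayesNet.factor, load, Equiv.symm_apply_apply]
    by_cases h : D.encA a k = true <;> simp [encodeStep, h]
  have hrest : ∀ v, (D.load β a).factor (D.var (.inr (.inr v))) (D.encodeStep a (s, s', o, r)) =
      D.net.factor (D.var (.inr (.inr v))) (D.encodeStep a (s, s', o, r)) := by
    intro v
    simp only [BayesNet.factor, load, Equiv.symm_apply_apply]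
  simp only [hS, hA, hrest, Finset.prod_const_one, one_mul]
  rfl

/-- The weight `c` is taken to be 1 for the total mass and an indicator for the evidence. -/
theorem sum_encodeStep (β : Fin kS → Finset (Fin N) → unitInterval) (a : Fin nA)
    (c : Fin nO → ℝ) :
    ∑ y : Fin nS × Fin nS × Fin nO × Fin nR, c y.2.2.1 * (D.belief β y.1 *
      (P.trans y.1 a y.2.1 * P.sensor y.2.1 a y.2.2.1 * P.rewardProb y.1 a y.2.2.2)) =
      ∑ o, c o * P.obsProb (D.belief β) a o := by
  simp only [Fintype.sum_prod_type]
  have hr : ∀ s s' o, ∑ r, c o * (D.belief β s * (P.trans s a s' * P.sensor s' a o *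
      P.rewardProb s a r)) = c o * (P.sensor s' a o * (P.trans s a s' * D.belief β s)) := by
    intro s s' o
    simp only [← Finset.mul_sum, P.rewardProb_sum]
    ring
  simp only [hr, POMDP.obsProb, Finset.mul_sum]
  rw [Finset.sum_comm]
  exact (Finset.sum_congr rfl fun _ _ => Finset.sum_comm).trans Finset.sum_comm

end DDN

theorem POMDP.sum_obsProb {nS nA nO nR : ℕ} (P : POMDP nS nA nO nR) (b : Fin nS → ℝ)
    (hb : ∑ s, b s = 1) (a : Fin nA) : ∑ o, P.obsProb b a o = 1 := by
  simp only [POMDP.obsProb]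
  rw [Finset.sum_comm]
  simp only [← Finset.sum_mul, P.sensor_sum, one_mul]
  rw [Finset.sum_comm]
  simp only [← Finset.sum_mul, P.trans_sum, one_mul, hb]

theorem POMDP.obsProb_nonneg {nS nA nO nR : ℕ} (P : POMDP nS nA nO nR) {b : Fin nS → ℝ}
    (hb : ∀ s, 0 ≤ b s) (a : Fin nA) (o : Fin nO) : 0 ≤ P.obsProb b a o :=
  Finset.sum_nonneg fun _ _ => mul_nonneg (P.sensor_nonneg _ _ _) <|
    Finset.sum_nonneg fun s _ => mul_nonneg (P.trans_nonneg _ _ _) (hb s)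

theorem POMDP.obsProb_le_one {nS nA nO nR : ℕ} (P : POMDP nS nA nO nR) {b : Fin nS → ℝ}
    (hb : ∀ s, 0 ≤ b s) (hb' : ∑ s, b s = 1) (a : Fin nA) (o : Fin nO) : P.obsProb b a o ≤ 1 := by
  rw [← P.sum_obsProb b hb' a]
  exact Finset.single_le_sum (fun o _ => P.obsProb_nonneg hb a o) (Finset.mem_univ o)

namespace DDN

variable {nS nA nO nR : ℕ} {P : POMDP nS nA nO nR} {N kS kA kO kR : ℕ}
  (D : DDN P N kS kA kO kR)

theorem belief_nonneg (β : Fin kS → Finset (Fin N) → unitInterval) (s : Fin nS) :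
    0 ≤ D.belief β s := by
  refine Finset.prod_nonneg fun k _ => ?_
  split_ifs
  · exact (β k _).2.1
  · exact sub_nonneg.2 (β k _).2.2

/-- The loaded network gives the evidence the observation probability of the POMDP. -/
theorem evidenceProb_load (β : Fin kS → Finset (Fin N) → unitInterval)
    (hβ : ∑ s, D.belief β s = 1) (a : Fin nA) (o : Fin nO) :
    (D.load β a).evidenceProb D.obsVars (D.obsEvidence o) = P.obsProb (D.belief β) a o := by
  -- Encoded transitions already have total mass 1, so assignments that encode no transition have
  -- probability 0 and cannot contribute to the evidence.
  have hmass : ∑ y, (D.load β a).prob (D.encodeStep a y) = ∑ x, (D.load β a).prob x := by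
    rw [BayesNet.sum_prob]
    have := D.sum_encodeStep β a fun _ => 1
    simp only [one_mul] at this
    simp only [load_prob_encodeStep]
    rw [this, P.sum_obsProb _ hβ]
  rw [BayesNet.evidenceProb, sum_ite_eq_of_mass (D.encodeStep_injective a)
    (BayesNet.prob_nonneg _) hmass]
  have hQ : ∀ y : Fin nS × Fin nS × Fin nO × Fin nR,
      (∀ j ∈ D.obsVars, D.encodeStep a y j = D.obsEvidence o j) ↔ y.2.2.1 = o := by
    intro y
    simp only [obsVars, Finset.mem_image, Finset.mem_univ, true_and, forall_exists_index,
      forall_apply_eq_imp_iff, encodeStep, obsEvidence, Equiv.symm_apply_apply, Sum.elim_inr,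
      Sum.elim_inl]
    exact ⟨fun h => D.encO.injective (funext h), fun h => by simp [h]⟩
  have h := D.sum_encodeStep β a fun o' => if o' = o then 1 else 0
  simp only [ite_mul, one_mul, zero_mul, Finset.sum_ite_eq', Finset.mem_univ, if_true] at h
  simp only [hQ, load_prob_encodeStep]
  exact h

end DDN

/-! ### Elementary inequalities. -/

theorem geom_sum_le_two_mul {y : ℝ} (hy : 2 ≤ y) (k : ℕ) :
    ∑ d ∈ Finset.range (k + 1), y ^ d ≤ 2 * y ^ k := by
  induction k with
  | zero => simp
  | succ k ih =>
    rw [Finset.sum_range_succ, pow_succ]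
    nlinarith [pow_pos (by linarith : 0 < y) k]

/-- Turns `2 ^ M ≤ C M` into the bound `M ≤ 4C`. -/
theorem sq_le_four_mul_two_pow (k : ℕ) : k * k ≤ 4 * 2 ^ k := by
  induction k with
  | zero => simp
  | succ k ih =>
    have : k < 2 ^ k := Nat.lt_two_pow_self
    rw [pow_succ]
    nlinarith

theorem rpow_neg_half {p : ℝ} (hp : 0 ≤ p) : p ^ (-(1 / 2) : ℝ) = 1 / Real.sqrt p := by
  rw [Real.rpow_neg hp, Real.sqrt_eq_rpow, one_div (p ^ (1 / 2 : ℝ))]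

/-! ### Cost bounds for a single input. -/

namespace Lookahead

/-- The side conditions on a single input. -/
structure Admissible (L : Lookahead) : Prop where
  two_le_H : 2 ≤ L.H
  one_le_n : 1 ≤ L.n
  one_le_M : 1 ≤ L.M
  two_le_AO : 2 ≤ L.nA * L.nO
  obsProb_pos : ∀ d < L.H - 1, ∀ h a o, 0 < L.obsProb d h a o

variable (L : Lookahead)

/-- The observation edges of the lookahead tree. -/
abbrev Edge : Type :=
  Σ d : Fin (L.H - 1), (Fin d → Fin L.nA × Fin L.nO) × Fin L.nA × Fin L.nO

/-- The observation probability of an edge. -/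
noncomputable def edgeProb (x : L.Edge) : ℝ := L.obsProb x.1 x.2.1 x.2.2.1 x.2.2.2

theorem edgeSum_eq (f : (d : ℕ) → (Fin d → Fin L.nA × Fin L.nO) → Fin L.nA → Fin L.nO → ℝ) :
    L.edgeSum f = ∑ x : L.Edge, f x.1 x.2.1 x.2.2.1 x.2.2.2 := by
  rw [edgeSum, Finset.sum_range, Fintype.sum_sigma]
  simp only [Fintype.sum_prod_type]

theorem nS_pos : 0 < L.nS := by
  by_contra h
  have h0 : IsEmpty (Fin L.nS) := by
    have : L.nS = 0 := by omega
    rw [this]; infer_instance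
  have := L.belief_sum 0 Fin.elim0
  simp at this

theorem obsProb_le_one (d : ℕ) (h : Fin d → Fin L.nA × Fin L.nO) (a : Fin L.nA) (o : Fin L.nO) :
    L.obsProb d h a o ≤ 1 :=
  L.pomdp.obsProb_le_one (L.ddn.belief_nonneg _) (L.belief_sum d h) a o

theorem evidenceProb_eq (d : ℕ) (h : Fin d → Fin L.nA × Fin L.nO) (a : Fin L.nA)
    (o : Fin L.nO) : (L.ddn.load (L.tables d h) a).evidenceProb L.ddn.obsVars (L.ddn.obsEvidence o) =
      L.obsProb d h a o :=
  L.ddn.evidenceProb_load _ (L.belief_sum d h) a o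

namespace Admissible

variable {L} (hL : L.Admissible)
include hL

theorem nA_pos : 0 < L.nA := Nat.pos_of_ne_zero fun h => by
  have := hL.two_le_AO; simp [h] at this

theorem nO_pos : 0 < L.nO := Nat.pos_of_ne_zero fun h => by
  have := hL.two_le_AO; simp [h] at this

theorem nR_pos : 0 < L.nR := by
  by_contra h
  have h0 : IsEmpty (Fin L.nR) := by
    have : L.nR = 0 := by omega
    rw [this]; infer_instance
  have := L.pomdp.rewardProb_sum ⟨0, L.nS_pos⟩ ⟨0, hL.nA_pos⟩
  simp at this

theorem N_pos : 0 < L.N := by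
  have h := hL.one_le_M
  rw [M, BayesNet.maxParents] at h
  obtain ⟨i, -, -⟩ := (Finset.le_sup_iff (by simp)).1 h
  exact i.pos

theorem one_le_X : 1 ≤ L.X := by
  have hS : (1 : ℝ) ≤ L.nS := by exact_mod_cast L.nS_pos
  have hR : (1 : ℝ) ≤ L.nR := by exact_mod_cast hL.nR_pos
  have hO : (0 : ℝ) ≤ L.nO := Nat.cast_nonneg _
  rw [X]
  exact one_le_pow₀ (one_le_mul_of_one_le_of_one_le (by linarith) (one_le_pow₀ hS))

theorem edgeProb_pos (x : L.Edge) : 0 < L.edgeProb x := hL.obsProb_pos _ x.1.2 _ _ _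

theorem ql_eq : L.ql = ∑ x : L.Edge, 1 / Real.sqrt (L.edgeProb x) := by
  rw [ql, edgeSum_eq]
  exact Finset.sum_congr rfl fun x _ => rpow_neg_half (hL.edgeProb_pos x).le

/-- In this form `c_l` is the sum of squares of the terms of `q_l`, so both comparisons between them
are immediate. -/
theorem cl_eq : L.cl = ∑ x : L.Edge, (1 / Real.sqrt (L.edgeProb x)) ^ 2 := by
  rw [cl, edgeSum_eq]
  refine Finset.sum_congr rfl fun x _ => ?_
  rw [div_pow, Real.sq_sqrt (hL.edgeProb_pos x).le, one_pow, one_div, edgeProb]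

theorem one_le_edge (x : L.Edge) : 1 ≤ 1 / Real.sqrt (L.edgeProb x) := by
  rw [le_div_iff₀ (Real.sqrt_pos.2 (hL.edgeProb_pos x)), one_mul]
  exact Real.sqrt_le_one.2 (L.obsProb_le_one _ _ _ _)

theorem one_le_ql : 1 ≤ L.ql := by
  have hH := hL.two_le_H
  -- An edge leaving the root; it exists because `H ≥ 2`.
  let x : L.Edge := ⟨⟨0, by omega⟩, Fin.elim0, ⟨0, hL.nA_pos⟩, ⟨0, hL.nO_pos⟩⟩
  rw [hL.ql_eq]
  exact (hL.one_le_edge x).trans (Finset.single_le_sum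
    (f := fun x => 1 / Real.sqrt (L.edgeProb x))
    (fun x _ => zero_le_one.trans (hL.one_le_edge x)) (Finset.mem_univ x))

theorem ql_pos : 0 < L.ql := zero_lt_one.trans_le hL.one_le_ql

theorem ql_le_cl : L.ql ≤ L.cl := by
  rw [hL.ql_eq, hL.cl_eq]
  exact Finset.sum_le_sum fun x _ => le_self_pow₀ (hL.one_le_edge x) two_ne_zero

theorem cl_pos : 0 < L.cl := hL.ql_pos.trans_le hL.ql_le_cl

theorem cl_le_ql_sq : L.cl ≤ L.ql ^ 2 := by
  rw [hL.ql_eq, hL.cl_eq]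
  exact Finset.sum_sq_le_sq_sum_of_nonneg fun x _ => zero_le_one.trans (hL.one_le_edge x)

theorem directSteps_le : L.ddn.net.directSteps ≤ 2 * (L.N * L.M) := by
  have h := L.ddn.net.directSteps_le
  have hM : (1 : ℝ) ≤ L.M := by exact_mod_cast hL.one_le_M
  have hN : (0 : ℝ) ≤ L.N := Nat.cast_nonneg _
  change _ ≤ (L.N : ℝ) * ((L.M : ℝ) + 1) at h
  nlinarith

theorem directSteps_pos : 0 < L.ddn.net.directSteps :=
  lt_of_lt_of_le (by exact_mod_cast hL.N_pos) L.ddn.net.le_directSteps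

theorem n_pos : (0 : ℝ) < L.n := by exact_mod_cast hL.one_le_n

/-- The 4 collects a factor 2 from the geometric series and a factor 2 from `directSteps_le`; the
ceiling in `m` costs at most one more `n`. -/
theorem directSamplingSteps_le (γ : ℝ) : L.directSamplingSteps γ ≤
    4 * (2 + (γ * (1 - γ)⁻¹) ^ 2) *
      (L.n * L.N * L.M * (L.nA : ℝ) ^ (L.H - 1) * (L.nO : ℝ) ^ (L.H - 1) * L.nA) := by
  have hsum : L.directSamplingSteps γ = (∑ d ∈ Finset.range L.H, ((L.nA : ℝ) * L.nO) ^ d) *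
      (L.nA * (((L.n : ℝ) + L.m γ) * L.ddn.net.directSteps)) := by
    rw [directSamplingSteps, Finset.sum_mul]
    refine Finset.sum_congr rfl fun d _ => ?_
    simp [Finset.sum_const]
  have hy : (2 : ℝ) ≤ (L.nA : ℝ) * L.nO := by exact_mod_cast hL.two_le_AO
  have hgeom := geom_sum_le_two_mul hy (L.H - 1)
  rw [Nat.sub_add_cancel (by linarith [hL.two_le_H])] at hgeom
  have hn : (1 : ℝ) ≤ L.n := by exact_mod_cast hL.one_le_n
  have hm : (L.m γ : ℝ) ≤ (γ * (1 - γ)⁻¹) ^ 2 * L.n + 1 :=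
    (Nat.ceil_lt_add_one (by positivity)).le
  have hD := hL.directSteps_le
  have hD0 := hL.directSteps_pos
  rw [hsum]
  calc _ ≤ 2 * ((L.nA : ℝ) * L.nO) ^ (L.H - 1) *
        (L.nA * (((2 + (γ * (1 - γ)⁻¹) ^ 2) * L.n) * (2 * (L.N * L.M)))) := by
        gcongr; linarith
    _ = _ := by rw [mul_pow]; ring

theorem l_pos {γ : ℝ} (h0 : 0 < γ) (h1 : γ < 1) : (0 : ℝ) < L.l γ := by
  have hR : (0 : ℝ) < L.nR := by exact_mod_cast hL.nR_pos
  have hS : (0 : ℝ) < L.nS := by exact_mod_cast L.nS_pos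
  have hn := hL.n_pos
  have hg : 0 < (1 - γ)⁻¹ := inv_pos.2 (by linarith)
  have hne : (Finset.range L.H).Nonempty := by
    rw [Finset.nonempty_range_iff]; have := hL.two_le_H; omega
  rw [l, Nat.cast_pos, Nat.ceil_pos]
  have h2 : 0 < ∑ k ∈ Finset.range L.H, γ ^ k := Finset.sum_pos (fun k _ => by positivity) hne
  have h3 : 0 < ∑ k ∈ Finset.range L.H, γ ^ k * ∑ j ∈ Finset.range (k + 1), (L.nS : ℝ) ^ j :=
    Finset.sum_pos (fun k _ => mul_pos (by positivity)
      (Finset.sum_pos (fun j _ => by positivity) (by simp))) hne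
  positivity

/-- The denominator is at least 1, and each inner sum has `k + 1` terms bounded by `S ^ (H - 1)`.
Discounting makes the remaining series converge, so the constant is uniform in `H`. -/
theorem belief_ratio_le {γ : ℝ} (h0 : 0 < γ) (h1 : γ < 1) :
    (∑ k ∈ Finset.range L.H, γ ^ k * ∑ j ∈ Finset.range (k + 1), (L.nS : ℝ) ^ j) /
        ∑ k ∈ Finset.range L.H, γ ^ k ≤
      (∑' k : ℕ, γ ^ k * ((k : ℝ) + 1)) * (L.nS : ℝ) ^ (L.H - 1) := by
  have hS : (1 : ℝ) ≤ L.nS := by exact_mod_cast L.nS_pos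
  have hden : 1 ≤ ∑ k ∈ Finset.range L.H, γ ^ k := by
    have := Finset.single_le_sum (f := fun k => γ ^ k) (s := Finset.range L.H)
      (fun k _ => by positivity) (Finset.mem_range.2 (by linarith [hL.two_le_H] : 0 < L.H))
    simpa using this
  have hsummable : Summable fun k : ℕ => γ ^ k * ((k : ℝ) + 1) := by
    have hγ : ‖γ‖ < 1 := by rwa [Real.norm_of_nonneg h0.le]
    refine ((summable_pow_mul_geometric_of_norm_lt_one 1 hγ).add
      (summable_geometric_of_norm_lt_one hγ)).congr fun k => ?_
    ring
  have hnum : ∀ k ∈ Finset.range L.H, γ ^ k * ∑ j ∈ Finset.range (k + 1), (L.nS : ℝ) ^ j ≤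
      γ ^ k * ((k : ℝ) + 1) * (L.nS : ℝ) ^ (L.H - 1) := by
    intro k hk
    rw [Finset.mem_range] at hk
    have : ∑ j ∈ Finset.range (k + 1), (L.nS : ℝ) ^ j ≤
        (Finset.range (k + 1)).card • (L.nS : ℝ) ^ (L.H - 1) :=
      Finset.sum_le_card_nsmul _ _ _ fun j hj => pow_le_pow_right₀ hS (by
        rw [Finset.mem_range] at hj; omega)
    rw [mul_assoc]
    refine mul_le_mul_of_nonneg_left ?_ (by positivity)
    simpa using this
  have hsum : ∑ k ∈ Finset.range L.H, γ ^ k * ((k : ℝ) + 1) ≤ ∑' k : ℕ, γ ^ k * ((k : ℝ) + 1) :=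
    hsummable.sum_le_tsum _ fun k _ => by positivity
  refine (div_le_self (Finset.sum_nonneg fun k _ => by positivity) hden).trans ?_
  refine (Finset.sum_le_sum hnum).trans ?_
  rw [← Finset.sum_mul]
  gcongr

end Admissible

/-- A constant `C` with `l ≤ C X n`. -/
noncomputable def beliefConst (γ : ℝ) : ℝ :=
  ((1 + γ * (1 - γ)⁻¹) * ∑' k : ℕ, γ ^ k * ((k : ℝ) + 1)) ^ 2 + 1

theorem beliefConst_pos (γ : ℝ) : 0 < beliefConst γ := by
  rw [beliefConst]; positivity

namespace Admissible

variable {L} (hL : L.Admissible)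
include hL

/-- Squaring `belief_ratio_le` gives `X`; the `+ 1` in `beliefConst` absorbs the ceiling, since `X n
≥ 1`. -/
theorem l_le {γ : ℝ} (h0 : 0 < γ) (h1 : γ < 1) : (L.l γ : ℝ) ≤ beliefConst γ * (L.X * L.n) := by
  have hn : (1 : ℝ) ≤ L.n := by exact_mod_cast hL.one_le_n
  have hX := hL.one_le_X
  have hg : 0 < (1 - γ)⁻¹ := inv_pos.2 (by linarith)
  have hR : (0 : ℝ) ≤ L.nR := Nat.cast_nonneg _
  have hO : (0 : ℝ) ≤ L.nO := Nat.cast_nonneg _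
  have hr0 : 0 ≤ (∑ k ∈ Finset.range L.H, γ ^ k * ∑ j ∈ Finset.range (k + 1), (L.nS : ℝ) ^ j) /
        ∑ k ∈ Finset.range L.H, γ ^ k :=
    div_nonneg (Finset.sum_nonneg fun k _ => by positivity)
      (Finset.sum_nonneg fun k _ => by positivity)
  have hr := hL.belief_ratio_le h0 h1
  refine (Nat.ceil_lt_add_one (by positivity)).le.trans ?_
  set r := (∑ k ∈ Finset.range L.H, γ ^ k * ∑ j ∈ Finset.range (k + 1), (L.nS : ℝ) ^ j) /
        ∑ k ∈ Finset.range L.H, γ ^ k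
  have hK : 0 ≤ ∑' k : ℕ, γ ^ k * ((k : ℝ) + 1) := tsum_nonneg fun k => by positivity
  set K := ∑' k : ℕ, γ ^ k * ((k : ℝ) + 1) with hKdef
  have hgg : 0 < γ * (1 - γ)⁻¹ := by positivity
  have h1' : 1 / 4 * (L.nR + γ * (1 - γ)⁻¹ * L.nO) ≤
      (1 + γ * (1 - γ)⁻¹) * ((L.nR : ℝ) + L.nO) := by nlinarith
  have hone : 1 ≤ L.X * L.n := one_le_mul_of_one_le_of_one_le hX hn
  calc _ ≤ ((1 + γ * (1 - γ)⁻¹) * ((L.nR : ℝ) + L.nO) *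
        (K * (L.nS : ℝ) ^ (L.H - 1))) ^ 2 * L.n + L.X * L.n := by gcongr
    _ = _ := by rw [beliefConst, ← hKdef, X]; ring

theorem classicalBeliefSteps_eq (γ : ℝ) :
    L.classicalBeliefSteps γ = L.l γ * L.ddn.net.directSteps * (1 + L.cl) := by
  have h : ∀ x : L.Edge, (L.l γ : ℝ) * (L.ddn.load (L.tables x.1 x.2.1) x.2.2.1).rejectionSteps
      L.ddn.obsVars (L.ddn.obsEvidence x.2.2.2) =
      L.l γ * L.ddn.net.directSteps * (L.obsProb x.1 x.2.1 x.2.2.1 x.2.2.2)⁻¹ := by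
    intro x
    rw [BayesNet.rejectionSteps_eq _ _ _ (by rw [evidenceProb_eq]; exact hL.edgeProb_pos x),
      evidenceProb_eq, mul_assoc]
    -- Loading changes tables only, so direct samples take the same number of steps.
    rfl
  rw [classicalBeliefSteps, edgeSum_eq, cl, edgeSum_eq, Finset.sum_congr rfl fun x _ => h x,
    ← Finset.mul_sum]
  ring

theorem quantumBeliefSteps_le (γ : ℝ) : L.quantumBeliefSteps γ ≤
    L.l γ * (L.ddn.net.directSteps + 36 * (L.N * 2 ^ L.M) * L.ql) := by
  have h : ∀ x : L.Edge, (L.l γ : ℝ) *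
      (L.ddn.load (L.tables x.1 x.2.1) x.2.2.1).quantumRejectionSteps
      L.ddn.obsVars (L.ddn.obsEvidence x.2.2.2) ≤
      L.l γ * (36 * (L.N * 2 ^ L.M) * (1 / Real.sqrt (L.edgeProb x))) := by
    intro x
    have := BayesNet.quantumRejectionSteps_le (L.ddn.load (L.tables x.1 x.2.1) x.2.2.1)
      L.ddn.obsVars (L.ddn.obsEvidence x.2.2.2) hL.N_pos
      (by rw [evidenceProb_eq]; exact hL.edgeProb_pos x)
    rw [evidenceProb_eq] at this
    exact mul_le_mul_of_nonneg_left this (Nat.cast_nonneg _)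
  rw [quantumBeliefSteps, edgeSum_eq, hL.ql_eq, mul_add, Finset.mul_sum, Finset.mul_sum]
  exact add_le_add le_rfl (Finset.sum_le_sum fun x _ => h x)

theorem le_quantumBeliefSteps (γ : ℝ) :
    1 / 2 * (L.l γ * L.ddn.net.directSteps * L.ql) ≤ L.quantumBeliefSteps γ := by
  have h : ∀ x : L.Edge, 1 / 2 * (L.l γ * L.ddn.net.directSteps *
      (1 / Real.sqrt (L.edgeProb x))) ≤ (L.l γ : ℝ) *
      (L.ddn.load (L.tables x.1 x.2.1) x.2.2.1).quantumRejectionSteps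
      L.ddn.obsVars (L.ddn.obsEvidence x.2.2.2) := by
    intro x
    have := BayesNet.le_quantumRejectionSteps (L.ddn.load (L.tables x.1 x.2.1) x.2.2.1)
      L.ddn.obsVars (L.ddn.obsEvidence x.2.2.2)
      (by rw [evidenceProb_eq]; exact hL.edgeProb_pos x)
    rw [evidenceProb_eq] at this
    refine le_trans (le_of_eq ?_) (mul_le_mul_of_nonneg_left this (Nat.cast_nonneg (L.l γ)))
    change _ = (L.l γ : ℝ) * (1 / 2 * L.ddn.net.directSteps * (1 / Real.sqrt (L.edgeProb x)))
    ring
  have hD := hL.directSteps_pos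
  rw [quantumBeliefSteps, edgeSum_eq, hL.ql_eq, Finset.mul_sum, Finset.mul_sum]
  exact (Finset.sum_le_sum fun x _ => h x).trans (le_add_of_nonneg_left (by positivity))

theorem one_le_nodes : 1 ≤ (L.nA : ℝ) ^ (L.H - 1) * (L.nO : ℝ) ^ (L.H - 1) :=
  one_le_mul_of_one_le_of_one_le (one_le_pow₀ (by exact_mod_cast hL.nA_pos))
    (one_le_pow₀ (by exact_mod_cast hL.nO_pos))

theorem directSamplingSteps_nonneg (γ : ℝ) : 0 ≤ L.directSamplingSteps γ := by
  have := hL.directSteps_pos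
  rw [directSamplingSteps]
  positivity

theorem classicalBeliefSteps_nonneg (γ : ℝ) : 0 ≤ L.classicalBeliefSteps γ := by
  have := hL.directSteps_pos
  have := hL.cl_pos
  rw [hL.classicalBeliefSteps_eq]
  positivity

theorem quantumBeliefSteps_nonneg (γ : ℝ) : 0 ≤ L.quantumBeliefSteps γ := by
  have := hL.directSteps_pos
  have := hL.ql_pos
  exact le_trans (by positivity) (hL.le_quantumBeliefSteps γ)

end Admissible

/-- The constant in the bounds for the two algorithms. -/
noncomputable def stepsConst (γ : ℝ) : ℝ :=
  4 * (2 + (γ * (1 - γ)⁻¹) ^ 2) + 38 * beliefConst γ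

namespace Admissible

variable {L} (hL : L.Admissible)
include hL

/-- Serves both algorithms. The sum `c` already runs over the whole tree, so the node factor in the
belief part is only a factor that is at least 1. The constant `38 = 36 + 2` covers the quantum
samples and the root; the classical case needs only 4. -/
theorem full_bound {γ w c belief : ℝ} (hMw : L.M ≤ w) (hc : 0 ≤ c)
    (hb : belief ≤ beliefConst γ * (L.X * L.n) * (38 * (L.N * w) * c)) :
    L.directSamplingSteps γ + belief ≤ stepsConst γ * L.full L.n w c := by
  have hd := hL.directSamplingSteps_le γ
  have hP := hL.one_le_nodes
  have hn := hL.n_pos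
  have hX := hL.one_le_X
  have hw : 0 ≤ w := (Nat.cast_nonneg _).trans hMw
  have hB := beliefConst_pos γ
  have h1 : (L.n : ℝ) * L.N * L.M * (L.nA : ℝ) ^ (L.H - 1) * (L.nO : ℝ) ^ (L.H - 1) * L.nA ≤
      L.full L.n w c := by
    calc _ ≤ (L.n : ℝ) * L.N * w * (L.nA : ℝ) ^ (L.H - 1) * (L.nO : ℝ) ^ (L.H - 1) *
          (L.nA + L.X * c) := by
          gcongr
          exact le_add_of_nonneg_right (by positivity)
      _ = _ := rfl
  have h2 : L.X * L.n * (L.N * w * c) ≤ L.full L.n w c := by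
    calc _ = L.n * L.N * w * 1 * (0 + L.X * c) := by ring
      _ ≤ L.n * L.N * w * ((L.nA : ℝ) ^ (L.H - 1) * (L.nO : ℝ) ^ (L.H - 1)) *
          (L.nA + L.X * c) := by
          gcongr
          exact Nat.cast_nonneg _
      _ = _ := by rw [full]; ring
  have hk : 0 ≤ 4 * (2 + (γ * (1 - γ)⁻¹) ^ 2) := by positivity
  have e1 := mul_le_mul_of_nonneg_left h1 hk
  have e2 := mul_le_mul_of_nonneg_left h2 (by positivity : 0 ≤ 38 * beliefConst γ)
  rw [stepsConst, add_mul]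
  linarith

theorem classicalSteps_le {γ : ℝ} (h0 : 0 < γ) (h1 : γ < 1) :
    L.classicalSteps γ ≤ stepsConst γ * L.full L.n L.M L.cl := by
  have hc : 1 ≤ L.cl := hL.one_le_ql.trans hL.ql_le_cl
  refine hL.full_bound le_rfl (by linarith) ?_
  have hD := hL.directSteps_le
  have hD0 := hL.directSteps_pos
  have hl := hL.l_le h0 h1
  rw [hL.classicalBeliefSteps_eq, mul_assoc]
  refine mul_le_mul hl ?_ (by positivity) ((Nat.cast_nonneg _).trans hl)
  have hNM : (0 : ℝ) ≤ L.N * L.M := by positivity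
  calc _ ≤ 2 * ((L.N : ℝ) * L.M) * (L.cl + L.cl) := by gcongr
    _ ≤ _ := by nlinarith [mul_nonneg hNM (zero_le_one.trans hc)]

theorem quantumSteps_le {γ : ℝ} (h0 : 0 < γ) (h1 : γ < 1) :
    L.quantumSteps γ ≤ stepsConst γ * L.full L.n (2 ^ L.M) L.ql := by
  have hq := hL.one_le_ql
  have hM : (L.M : ℝ) ≤ 2 ^ L.M := by exact_mod_cast (Nat.lt_two_pow_self (n := L.M)).le
  refine hL.full_bound hM (by linarith) ?_
  have hD := hL.directSteps_le
  have hD0 := hL.directSteps_pos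
  have hl := hL.l_le h0 h1
  refine (hL.quantumBeliefSteps_le γ).trans ?_
  refine mul_le_mul hl ?_ (by positivity) ((Nat.cast_nonneg _).trans hl)
  calc _ ≤ 2 * ((L.N : ℝ) * 2 ^ L.M) * L.ql + 36 * (L.N * 2 ^ L.M) * L.ql := by
        gcongr
        refine hD.trans ?_
        calc _ ≤ 2 * ((L.N : ℝ) * 2 ^ L.M) * 1 := by rw [mul_one]; gcongr
          _ ≤ _ := by gcongr
    _ = _ := by ring

theorem classicalSteps_nonneg (γ : ℝ) : 0 ≤ L.classicalSteps γ :=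
  add_nonneg (hL.directSamplingSteps_nonneg γ) (hL.classicalBeliefSteps_nonneg γ)

theorem quantumSteps_nonneg (γ : ℝ) : 0 ≤ L.quantumSteps γ :=
  add_nonneg (hL.directSamplingSteps_nonneg γ) (hL.quantumBeliefSteps_nonneg γ)

end Admissible

end Lookahead

/-! ### Simplified expressions, precision and confidence. -/

namespace Lookahead

theorem reduced_eq (L : Lookahead) (ν w c : ℝ) : L.reduced ν w c =
    ν * w * (L.N * (L.nA : ℝ) ^ (L.H - 1) * (L.nO : ℝ) ^ (L.H - 1) * L.X * c) := by
  rw [reduced]; ring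

namespace Admissible

variable {L : Lookahead} (hL : L.Admissible)
include hL

theorem reduced_ne_zero {c : ℝ} (hc : c ≠ 0) : L.reduced L.n L.M c ≠ 0 := by
  have h1 := hL.n_pos
  have h2 := hL.one_le_X
  have h3 : (0 : ℝ) < L.nA := by exact_mod_cast hL.nA_pos
  have h4 : (0 : ℝ) < L.nO := by exact_mod_cast hL.nO_pos
  have h5 : (0 : ℝ) < L.N := by exact_mod_cast hL.N_pos
  have h6 : (0 : ℝ) < L.M := by exact_mod_cast hL.one_le_M
  have h7 : 0 < L.X := by linarith
  rw [reduced]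
  positivity

theorem reduced_div (c c' : ℝ) (hc : c' ≠ 0) :
    L.reduced L.n L.M c / L.reduced L.n L.M c' = c / c' := by
  have h := hL.reduced_ne_zero hc
  rw [div_eq_div_iff h hc, reduced, reduced]
  ring

variable {T : ℕ} {δ : ℝ}

/-- The confidence term and its simplified form, which is at least `4`. -/
theorem two_div_sigma_bounds (hT : 1 ≤ T) (hδ0 : 0 < δ) (hδ1 : δ < 1) :
    4 ≤ (T + L.H / ((L.nA : ℝ) * L.nO)) * ((L.nA : ℝ) ^ (L.H + 1) * (L.nO : ℝ) ^ L.H / δ) ∧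
    1 ≤ 2 / L.sigma T δ ∧
    2 / L.sigma T δ ≤
      14 * ((T + L.H / ((L.nA : ℝ) * L.nO)) * ((L.nA : ℝ) ^ (L.H + 1) * (L.nO : ℝ) ^ L.H / δ)) := by
  have hA : (1 : ℝ) ≤ L.nA := by exact_mod_cast hL.nA_pos
  have hO : (1 : ℝ) ≤ L.nO := by exact_mod_cast hL.nO_pos
  have hy : (2 : ℝ) ≤ (L.nA : ℝ) * L.nO := by exact_mod_cast hL.two_le_AO
  have hH : (2 : ℝ) ≤ L.H := by exact_mod_cast hL.two_le_H
  have hT' : (1 : ℝ) ≤ T := by exact_mod_cast hT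
  rw [sigma]
  have hpow : (L.nA : ℝ) ^ (L.H + 1) * (L.nO : ℝ) ^ L.H =
      L.nA * ((L.nA : ℝ) * L.nO) ^ L.H := by rw [mul_pow]; ring
  rw [hpow]
  set y : ℝ := (L.nA : ℝ) * L.nO
  set A := (L.nA : ℝ)
  set H := (L.H : ℝ)
  set t := (T : ℝ)
  have hyH : 4 ≤ y ^ L.H := by
    calc (4 : ℝ) = 2 ^ 2 := by norm_num
      _ ≤ y ^ 2 := by gcongr
      _ ≤ y ^ L.H := pow_le_pow_right₀ (by linarith) hL.two_le_H
  have hq0 : 0 ≤ H / y := by positivity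
  have hdelta : 1 ≤ 1 / δ := by rw [le_div_iff₀ hδ0]; linarith
  -- Since `y ≥ 2`, `y ≤ 2 (y - 1)`.
  have hfrac : y * ((H - 1) / (y - 1) ^ 2) ≤ 4 * (H / y) := by
    have hy1 : 0 < (y - 1) ^ 2 := by have : 0 < y - 1 := by linarith
                                     positivity
    rw [mul_div_assoc', mul_div_assoc', div_le_div_iff₀ hy1 (by linarith)]
    have : y ^ 2 ≤ 4 * (y - 1) ^ 2 := by nlinarith
    nlinarith [mul_le_mul_of_nonneg_left this (by linarith : 0 ≤ H - 1), sq_nonneg (y - 1)]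
  have hfrac0 : 0 ≤ y * ((H - 1) / (y - 1) ^ 2) :=
    mul_nonneg (by linarith) (div_nonneg (by linarith) (sq_nonneg _))
  set z := y * ((H - 1) / (y - 1) ^ 2)
  have hB0 : 2 ≤ 2 + A * (t + 4 + z) := by
    have : 0 ≤ A * (t + 4 + z) := by positivity
    linarith
  -- With `A, t ≥ 1`, the 2 costs `2At` and `t + 4 ≤ 5t`, which makes 7; doubled, it is the 14 of
  -- the statement.
  have hB : 2 + A * (t + 4 + z) ≤ 7 * (A * (t + H / y)) := by
    have h1 : 2 ≤ A * (2 * t) := by nlinarith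
    have h2 : A * (t + 4 + z) ≤ A * (5 * t + 4 * (H / y)) := by gcongr; linarith
    have h3 : 0 ≤ A * (3 * (H / y)) := by positivity
    linarith
  have hval : 2 / (δ * (y ^ L.H)⁻¹ * (2 + A * (t + 4 + z))⁻¹) =
      2 * (1 / δ) * y ^ L.H * (2 + A * (t + 4 + z)) := by
    have : 2 + A * (t + 4 + z) ≠ 0 := by linarith
    have : y ^ L.H ≠ 0 := by linarith
    field_simp
  rw [hval]
  have hYeq : (t + H / y) * (A * y ^ L.H / δ) = (1 / δ) * y ^ L.H * (A * (t + H / y)) := by ring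
  rw [hYeq]
  refine ⟨?_, ?_, ?_⟩
  · have h1 : 1 ≤ A * (t + H / y) := one_le_mul_of_one_le_of_one_le hA (by linarith)
    calc (4 : ℝ) = 1 * 4 * 1 := by norm_num
      _ ≤ _ := by gcongr
  · calc (1 : ℝ) ≤ 2 * 1 * 4 * 2 := by norm_num
      _ ≤ _ := by gcongr
  · calc _ ≤ 2 * (1 / δ) * y ^ L.H * (7 * (A * (t + H / y))) := by gcongr
      _ = _ := by ring

theorem sampleBound_le {γ rmax ε C : ℝ} (h1 : γ < 1) (hr : 0 < rmax) (hT : 1 ≤ T) (hδ0 : 0 < δ)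
    (hδ1 : δ < 1) (hε0 : 0 < ε) (hε : 2 * γ ^ L.H * (1 - γ)⁻¹ * rmax < ε)
    (hC : ε ≤ C * (ε - 2 * γ ^ L.H * (1 - γ)⁻¹ * rmax)) :
    |L.sampleBound γ rmax T ε δ| ≤
      3 / 2 * (rmax * C * (8 * (1 - γ)⁻¹ + 4)) ^ 2 * |L.precisionFactor T ε δ| := by
  obtain ⟨hY, hσ, hσY⟩ := hL.two_div_sigma_bounds hT hδ0 hδ1
  have hS : (1 : ℝ) ≤ (L.nS : ℝ) ^ T := one_le_pow₀ (by exact_mod_cast L.nS_pos)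
  rw [sampleBound, precisionFactor]
  set Y := (T + L.H / ((L.nA : ℝ) * L.nO)) * ((L.nA : ℝ) ^ (L.H + 1) * (L.nO : ℝ) ^ L.H / δ)
  have hlog0 : 0 ≤ Real.log (2 / L.sigma T δ) := Real.log_nonneg hσ
  -- As `Y ≥ 4`, the factor 14 is absorbed into a power, which becomes a factor 3 outside the
  -- logarithm.
  have hcube : 14 * Y ≤ Y ^ 3 := by
    have : 14 ≤ Y ^ 2 := by nlinarith
    rw [pow_succ]
    gcongr
  have hlog : Real.log (2 / L.sigma T δ) ≤ 3 * Real.log Y := by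
    calc _ ≤ Real.log (Y ^ 3) := Real.log_le_log (by linarith) (hσY.trans hcube)
      _ = _ := by rw [Real.log_pow]; norm_num
  have hY0 : 0 ≤ Real.log Y := Real.log_nonneg (by linarith)
  have hg : 0 < (1 - γ)⁻¹ := inv_pos.2 (by linarith)
  set g := ε - 2 * γ ^ L.H * (1 - γ)⁻¹ * rmax with hgdef
  have hg0 : 0 < g := by linarith
  rw [abs_of_nonneg (by positivity), abs_of_nonneg (by positivity)]
  have hC0 : 0 < C := by
    by_contra h
    have := mul_nonpos_of_nonpos_of_nonneg (not_lt.1 h) hg0.le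
    linarith
  have hquot : rmax / g ≤ rmax * C / ε := by
    rw [div_le_div_iff₀ hg0 hε0]
    calc rmax * ε ≤ rmax * (C * g) := by gcongr
      _ = _ := by ring
  have hfac : 8 * (1 - γ)⁻¹ + 4 * (L.nS : ℝ) ^ T ≤ (8 * (1 - γ)⁻¹ + 4) * (L.nS : ℝ) ^ T := by
    nlinarith
  calc _ ≤ 1 / 2 * (3 * Real.log Y) *
        (rmax * C / ε * ((8 * (1 - γ)⁻¹ + 4) * (L.nS : ℝ) ^ T)) ^ 2 := by gcongr
    _ = _ := by ring

end Admissible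

/-! ### Asymptotics along a family. -/

variable {ι : Type*} {F : Filter ι} {L : ι → Lookahead}

theorem isLittleO_of_isLittleO_div (hL : ∀ i, (L i).Admissible)
    (hdom : (fun i => 1 / (L i).ql) =o[F] fun i => (L i).X / (L i).nA) {c : ι → ℝ}
    (hc : ∀ i, (L i).ql ≤ c i) :
    (fun i => ((L i).nA : ℝ)) =o[F] fun i => (L i).X * c i := by
  have h := hdom.mul_isBigO (isBigO_refl (fun i => ((L i).nA : ℝ) * (L i).ql) F)
  have hA : ∀ i, ((L i).nA : ℝ) ≠ 0 := fun i => by exact_mod_cast (hL i).nA_pos.ne'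
  have hq : ∀ i, (L i).ql ≠ 0 := fun i => (hL i).ql_pos.ne'
  have h' : (fun i => ((L i).nA : ℝ)) =o[F] fun i => (L i).X * (L i).ql := by
    refine (h.congr_left fun i => ?_).congr_right fun i => ?_
    · have := hq i; field_simp
    · have := hA i; field_simp
  refine h'.trans_isBigO (IsBigO.of_bound 1 (Eventually.of_forall fun i => ?_))
  have hX := (hL i).one_le_X
  have hq0 := (hL i).ql_pos
  have := hc i
  rw [one_mul, Real.norm_of_nonneg (by positivity), Real.norm_of_nonneg
    (mul_nonneg (by linarith) (by linarith))]
  gcongr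

/-- The difference is the common prefactor times `A`. Multiplying the little-o relation by the
prefactor needs no sign or nonvanishing condition, so `ν` and `w` are arbitrary. -/
theorem full_isEquivalent_reduced {c : ι → ℝ}
    (h : (fun i => ((L i).nA : ℝ)) =o[F] fun i => (L i).X * c i) (ν w : ι → ℝ) :
    (fun i => (L i).full (ν i) (w i) (c i)) ~[F] fun i => (L i).reduced (ν i) (w i) (c i) := by
  have h' := (isBigO_refl (fun i => ν i * (L i).N * w i * ((L i).nA : ℝ) ^ ((L i).H - 1) *
    ((L i).nO : ℝ) ^ ((L i).H - 1)) F).mul_isLittleO h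
  refine (h'.congr_left fun i => ?_).congr_right fun i => ?_
  · simp only [Pi.sub_apply, full, reduced]; ring
  · simp only [reduced]; ring

theorem isBigO_reduced_of_le {f : ι → ℝ} (hf : ∀ i, 0 ≤ f i) {C : ℝ} {ν w c : ι → ℝ}
    (hle : ∀ i, f i ≤ C * (L i).full (ν i) (w i) (c i))
    (h : (fun i => ((L i).nA : ℝ)) =o[F] fun i => (L i).X * c i) :
    f =O[F] fun i => (L i).reduced (ν i) (w i) (c i) := by
  refine IsBigO.trans (IsBigO.of_bound |C| (Eventually.of_forall fun i => ?_))
    (full_isEquivalent_reduced h ν w).isBigO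
  rw [Real.norm_of_nonneg (hf i), Real.norm_eq_abs, ← abs_mul]
  exact (hle i).trans (le_abs_self _)

theorem isBigO_reduced_reduced {ν ν' w w' c : ι → ℝ} (hν : ν =O[F] ν') (hw : w =O[F] w') :
    (fun i => (L i).reduced (ν i) (w i) (c i)) =O[F]
      fun i => (L i).reduced (ν' i) (w' i) (c i) := by
  simp only [reduced_eq]
  exact (hν.mul hw).mul (isBigO_refl _ F)

theorem isBigO_precisionFactor (hL : ∀ i, (L i).Admissible) {γ : ℝ} (h0 : 0 < γ) (h1 : γ < 1)
    {rmax : ℝ} {T : ι → ℕ} {ε δ : ι → ℝ} (hr : 0 < rmax) (hT : ∀ i, 1 ≤ T i)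
    (hδ : ∀ i, 0 < δ i ∧ δ i < 1) (hε : ∀ i, 2 * γ ^ (L i).H * (1 - γ)⁻¹ * rmax < ε i)
    (hεO : ε =O[F] fun i => ε i - 2 * γ ^ (L i).H * (1 - γ)⁻¹ * rmax) :
    (fun i => (L i).sampleBound γ rmax (T i) (ε i) (δ i)) =O[F]
      fun i => (L i).precisionFactor (T i) (ε i) (δ i) := by
  obtain ⟨C, hC⟩ := hεO.bound
  refine IsBigO.of_bound (3 / 2 * (rmax * C * (8 * (1 - γ)⁻¹ + 4)) ^ 2) (hC.mono fun i hi => ?_)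
  have hg : 0 < (1 - γ)⁻¹ := inv_pos.2 (by linarith)
  have hε0 : 0 < ε i := lt_trans (by positivity) (hε i)
  rw [Real.norm_of_nonneg hε0.le, Real.norm_of_nonneg (by linarith [hε i])] at hi
  exact (hL i).sampleBound_le h1 hr (hT i) (hδ i).1 (hδ i).2 hε0 (hε i) hi

theorem isTheta_classicalBeliefSteps (hL : ∀ i, (L i).Admissible) (γ : ℝ) :
    (fun i => (L i).classicalBeliefSteps γ) =Θ[F]
      fun i => (L i).l γ * (L i).ddn.net.directSteps * (L i).cl := by
  constructor
  · refine IsBigO.of_bound 2 (Eventually.of_forall fun i => ?_)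
    have hD := (hL i).directSteps_pos
    have hc : 1 ≤ (L i).cl := (hL i).one_le_ql.trans (hL i).ql_le_cl
    rw [Real.norm_of_nonneg ((hL i).classicalBeliefSteps_nonneg γ),
      Real.norm_of_nonneg (by positivity), (hL i).classicalBeliefSteps_eq]
    calc _ ≤ (L i).l γ * (L i).ddn.net.directSteps * ((L i).cl + (L i).cl) := by gcongr
      _ = _ := by ring
  · refine IsBigO.of_bound 1 (Eventually.of_forall fun i => ?_)
    have hD := (hL i).directSteps_pos
    have hc := (hL i).cl_pos
    rw [Real.norm_of_nonneg ((hL i).classicalBeliefSteps_nonneg γ),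
      Real.norm_of_nonneg (by positivity), (hL i).classicalBeliefSteps_eq, one_mul]
    gcongr
    linarith

/-- The condition on `M` is needed only for the upper bound: it bounds `2 ^ M`, and `N ≤
directSteps` then brings `N 2 ^ M` down to the cost of a direct sample. -/
theorem isTheta_quantumBeliefSteps (hL : ∀ i, (L i).Admissible) (γ : ℝ)
    (hM : (fun i => (2 : ℝ) ^ (L i).M) =O[F] fun i => ((L i).M : ℝ)) :
    (fun i => (L i).quantumBeliefSteps γ) =Θ[F]
      fun i => (L i).l γ * (L i).ddn.net.directSteps * (L i).ql := by
  constructor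
  · obtain ⟨C, hC⟩ := hM.bound
    refine IsBigO.of_bound (1 + 36 * (4 * C ^ 2)) (hC.mono fun i hi => ?_)
    have hD := (hL i).directSteps_pos
    have hq := (hL i).one_le_ql
    rw [Real.norm_of_nonneg (by positivity), Real.norm_of_nonneg (by positivity)] at hi
    rw [Real.norm_of_nonneg ((hL i).quantumBeliefSteps_nonneg γ),
      Real.norm_of_nonneg (by positivity)]
    have hM1 : (0 : ℝ) < (L i).M := by exact_mod_cast (hL i).one_le_M
    have hM2 : ((L i).M : ℝ) * (L i).M ≤ 4 * 2 ^ (L i).M := by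
      exact_mod_cast sq_le_four_mul_two_pow (L i).M
    have hM3 : ((L i).M : ℝ) ≤ 4 * C := le_of_mul_le_mul_right (by linarith) hM1
    have hM4 : (2 : ℝ) ^ (L i).M ≤ 4 * C ^ 2 := by nlinarith
    have hN := (L i).ddn.net.le_directSteps
    refine ((hL i).quantumBeliefSteps_le γ).trans ?_
    calc _ ≤ (L i).l γ * ((L i).ddn.net.directSteps * (L i).ql +
          36 * ((L i).ddn.net.directSteps * (4 * C ^ 2)) * (L i).ql) := by
          gcongr
          exact le_mul_of_one_le_right hD.le hq
      _ = _ := by ring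
  · refine IsBigO.of_bound 2 (Eventually.of_forall fun i => ?_)
    have hD := (hL i).directSteps_pos
    have hq := (hL i).ql_pos
    have := (hL i).le_quantumBeliefSteps γ
    rw [Real.norm_of_nonneg ((hL i).quantumBeliefSteps_nonneg γ),
      Real.norm_of_nonneg (by positivity)]
    linarith

end Lookahead

/-! ### Assembly of the statement. -/

theorem corollary1 {ι : Type*} (F : Filter ι) (L : ι → Lookahead) (γ : ℝ)
    (hγ0 : 0 < γ) (hγ1 : γ < 1)
    (hH : ∀ i, 2 ≤ (L i).H)
    (hn : ∀ i, 1 ≤ (L i).n)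
    (hM : ∀ i, 1 ≤ (L i).M)
    (hAO : ∀ i, 2 ≤ (L i).nA * (L i).nO)
    (hpos : ∀ i, ∀ d < (L i).H - 1, ∀ h a o, 0 < (L i).obsProb d h a o)
    (hdom : (fun i => 1 / (L i).ql) =o[F] fun i => (L i).X / (L i).nA) :
    -- the complexities of the two algorithms
    ((fun i => (L i).classicalSteps γ) =O[F]
        fun i => (L i).reduced (L i).n (L i).M (L i).cl) ∧
    ((fun i => (L i).quantumSteps γ) =O[F]
        fun i => (L i).reduced (L i).n (2 ^ (L i).M) (L i).ql) ∧
    (((fun i => (2 : ℝ) ^ (L i).M) =O[F] fun i => ((L i).M : ℝ)) →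
      (fun i => (L i).quantumSteps γ) =O[F]
        fun i => (L i).reduced (L i).n (L i).M (L i).ql) ∧
    -- the same in terms of the precision, the confidence and the stopping time
    (∀ (rmax : ℝ) (T : ι → ℕ) (ε δ : ι → ℝ), 0 < rmax →
      (∀ i r, |(L i).pomdp.rewardValue r| ≤ rmax) →
      (∀ i, 1 ≤ T i) → (∀ i, 0 < δ i ∧ δ i < 1) →
      (∀ i, 2 * γ ^ (L i).H * (1 - γ)⁻¹ * rmax < ε i) →
      (ε =O[F] fun i => ε i - 2 * γ ^ (L i).H * (1 - γ)⁻¹ * rmax) →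
      ((fun i => ((L i).n : ℝ)) =O[F] fun i => (L i).sampleBound γ rmax (T i) (ε i) (δ i)) →
      ((fun i => (L i).classicalSteps γ) =O[F] fun i =>
        (L i).reduced ((L i).precisionFactor (T i) (ε i) (δ i)) (L i).M (L i).cl) ∧
      ((fun i => (L i).quantumSteps γ) =O[F] fun i =>
        (L i).reduced ((L i).precisionFactor (T i) (ε i) (δ i)) (2 ^ (L i).M) (L i).ql) ∧
      (((fun i => (2 : ℝ) ^ (L i).M) =O[F] fun i => ((L i).M : ℝ)) →
        (fun i => (L i).quantumSteps γ) =O[F] fun i =>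
          (L i).reduced ((L i).precisionFactor (T i) (ε i) (δ i)) (L i).M (L i).ql)) ∧
    -- the unsimplified expressions become the simplified ones, whatever the common factors
    (∀ ν w : ι → ℝ,
      (fun i => (L i).full (ν i) (w i) (L i).cl) ~[F]
        (fun i => (L i).reduced (ν i) (w i) (L i).cl) ∧
      (fun i => (L i).full (ν i) (w i) (L i).ql) ~[F]
        (fun i => (L i).reduced (ν i) (w i) (L i).ql)) ∧
    -- the speedup
    (∀ i, (L i).reduced (L i).n (L i).M (L i).cl / (L i).reduced (L i).n (L i).M (L i).ql
        = (L i).cl / (L i).ql) ∧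
    ((fun i => (L i).full (L i).n (L i).M (L i).cl / (L i).full (L i).n (L i).M (L i).ql) ~[F]
        fun i => (L i).cl / (L i).ql) ∧
    (((fun i => (2 : ℝ) ^ (L i).M) =O[F] fun i => ((L i).M : ℝ)) →
      (fun i => (L i).classicalBeliefSteps γ / (L i).quantumBeliefSteps γ) =Θ[F]
        fun i => (L i).cl / (L i).ql) ∧
    (∀ i, 1 ≤ (L i).cl / (L i).ql ∧ (L i).cl / (L i).ql ≤ (L i).ql) := by
  have hL : ∀ i, (L i).Admissible := fun i => ⟨hH i, hn i, hM i, hAO i, hpos i⟩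
  have hq := Lookahead.isLittleO_of_isLittleO_div hL hdom fun i => le_rfl
  have hc := Lookahead.isLittleO_of_isLittleO_div hL hdom fun i => (hL i).ql_le_cl
  have hclassical := Lookahead.isBigO_reduced_of_le
    (fun i => (hL i).classicalSteps_nonneg γ) (fun i => (hL i).classicalSteps_le hγ0 hγ1) hc
  have hquantum := Lookahead.isBigO_reduced_of_le
    (fun i => (hL i).quantumSteps_nonneg γ) (fun i => (hL i).quantumSteps_le hγ0 hγ1) hq
  have hfull := fun ν w => Lookahead.full_isEquivalent_reduced (L := L) (F := F) hc ν w
  have hfull' := fun ν w => Lookahead.full_isEquivalent_reduced (L := L) (F := F) hq ν w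
  have hdiv : ∀ i, (L i).reduced (L i).n (L i).M (L i).cl / (L i).reduced (L i).n (L i).M (L i).ql
      = (L i).cl / (L i).ql := fun i => (hL i).reduced_div _ _ (hL i).ql_pos.ne'
  refine ⟨hclassical, hquantum,
    fun h2 => hquantum.trans (Lookahead.isBigO_reduced_reduced (isBigO_refl _ F) h2), ?_,
    fun ν w => ⟨hfull ν w, hfull' ν w⟩, hdiv, ?_, fun h2 => ?_, fun i => ⟨?_, ?_⟩⟩
  · intro rmax T ε δ hr _ hT hδ hε hεO hnO
    have hν := hnO.trans (Lookahead.isBigO_precisionFactor hL hγ0 hγ1 hr hT hδ hε hεO)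
    exact ⟨hclassical.trans (Lookahead.isBigO_reduced_reduced hν (isBigO_refl _ F)),
      hquantum.trans (Lookahead.isBigO_reduced_reduced hν (isBigO_refl _ F)),
      fun h2 => hquantum.trans (Lookahead.isBigO_reduced_reduced hν h2)⟩
  · exact ((hfull (fun i => (L i).n) (fun i => (L i).M)).div
      (hfull' (fun i => (L i).n) (fun i => (L i).M))).congr_right (Eventually.of_forall hdiv)
  · refine ((Lookahead.isTheta_classicalBeliefSteps hL γ).div
      (Lookahead.isTheta_quantumBeliefSteps hL γ h2)).trans_eventuallyEq
      (Eventually.of_forall fun i => ?_)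
    have hD := (hL i).directSteps_pos
    have hl := (hL i).l_pos hγ0 hγ1
    -- The common factor `l * directSteps` cancels and leaves `c_l / q_l`.
    exact mul_div_mul_left _ _ (mul_pos hl hD).ne'
  · rw [le_div_iff₀ (hL i).ql_pos, one_mul]
    exact (hL i).ql_le_cl
  · rw [div_le_iff₀ (hL i).ql_pos, ← sq]
    exact (hL i).cl_le_ql_sq
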